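/- Let $n\in\mathbb{N}$, $a,b>0$, let $\mathcal{B}_2$ be the Hilbert space of Hilbert--Schmidt operators on $L^2(\mathbb{R}^n)$, with $(T,S)=\mathrm{tr}(TS^*)$, let $d\kappa(\lambda)=d\lambda/|\lambda|$ on $\mathbb{R}^*=\mathbb{R}\setminus\{0\}$, and let $\mathcal{G}\in L^2(\mathbb{R}^*,\mathcal{B}_2;d\kappa)$. Notation. For $\lambda\in\mathbb{R}^*$ let $\pi_\lambda(x,y,t)\varphi(\xi)=e^{2\pi i\lambda t}e^{2\pi i\lambda(x\cdot\xi+\frac12x\cdot y)}\varphi(\xi+y)$ be the Schrödinger representation of the Heisenberg group on $L^2(\mathbb{R}^n)$. On $L^2(\mathbb{R}^*,\mathcal{B}_2;d\kappa)$ put $(T_\omega F)(\lambda)=F(\lambda/\omega)$ and $(M_{(x,y,t)}F)(\lambda)=\pi_\lambda(x,y,t)F(\lambda)$, and let $$\mathcal{U}(\mathcal{G})=\{T_{e^{bp}}M_{a(2k,l,m)}\mathcal{G}:k,l\in\mathbb{Z}^n,\ m,p\in\mathbb{Z}\},$$ a family indexed by $(k,l,m,p)\in\mathbb{Z}^{2n+2}$.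 For $\nu>0$ and $j\in\{1,-1\}$ let $\widehat F(\nu,j)=\int_{\mathbb{R}^*}\overline{(\nu,j)(\lambda)}\,F(\lambda)\,d\kappa(\lambda)$ (extended from $L^1\cap L^2$ to $L^2$ by continuity), where $(\nu,j)(\lambda)=e^{2\pi i\log\nu\log|\lambda|}\varsigma_j(\lambda/|\lambda|)$, $\varsigma_1\equiv1$, $\varsigma_{-1}(\pm1)=\pm1$. The Weyl transform $W(g)\varphi=\int_{\mathbb{R}^{2n}}g(x,y)\,\pi_1(x,y,0)\varphi\,dx\,dy$ is an isometric isomorphism of $L^2(\mathbb{R}^{2n})=L^2(\mathbb{C}^n)$ onto $\mathcal{B}_2$; let $g_{k,l,m}(\cdot,\nu,j)\in L^2(\mathbb{C}^n)$ be the function with $W(g_{k,l,m}(\cdot,\nu,j))=(M_{a(2k,l,m)}\mathcal{G})^{\wedge}(\nu,j)$, and let $$w_{g_{k,l,m}}(\nu)=\sum_{j\in\{1,-1\}}\sum_{s\in\mathbb{Z}}\|g_{k,l,m}(\cdot,\nu e^{s/b},j)\|_{L^2(\mathbb{C}^n)}^2,\qquad \nu\in(1,e^{1/b}).$$ A family $(f_i)_{i\in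 I}$ in a Hilbert space is a Riesz sequence if $f_i=Ue_i$ for an orthonormal basis $(e_i)_{i\in I}$ of $P=\overline{\mathrm{span}}\{f_i\}$ and a bounded invertible operator $U$ on $P$; it has bounds $A,B>0$ if $A\sum|c_i|^2\le\|\sum c_if_i\|^2\le B\sum|c_i|^2$ for all finite sequences $(c_i)$ of scalars. Theorem. Let $A,B>0$. (1) Suppose that for each $j\in\{1,-1\}$ and $s\in\mathbb{Z}$, for a.e. $\nu\in(1,e^{1/b})$, the functions $g_{k,l,m}(\cdot,\nu e^{s/b},j)$, $(k,l,m)\in\mathbb{Z}^{2n+1}$, are pairwise orthogonal in $L^2(\mathbb{C}^n)$. Then $\mathcal{U}(\mathcal{G})$ is a Riesz sequence with bounds $A,B$ if and only if, for every $(k,l,m)\in\mathbb{Z}^{2n+1}$, $Ab\le w_{g_{k,l,m}}(\nu)\le Bb$ for a.e. $\nu\in(1,e^{1/b})$. (2) Suppose only that for a.e. $\nu\in(1,e^{1/b})$ and all $(k,l,m)\ne(k',l',m')$ in $\mathbb{Z}^{2n+1}$ $$\sum_{j\in\{1,-1\}}\sum_{s\in\mathbb{Z}}\langle g_{k,l,m}(\cdot,\nu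 e^{s/b},j),g_{k',l',m'}(\cdot,\nu e^{s/b},j)\rangle_{L^2(\mathbb{C}^n)}=0.$$ Then $\mathcal{U}(\mathcal{G})$ is a Riesz sequence with bounds $A,B$ if and only if, for every $(k,l,m)\in\mathbb{Z}^{2n+1}$, $2Ab\le w_{g_{k,l,m}}(\nu)\le 2Bb$ for a.e. $\nu\in(1,e^{1/b})$. (The pointwise hypothesis of (1) is very restrictive: it holds only for $\mathcal{G}=0$, in which case both sides of both equivalences fail. The factor $2$ in (2) comes from $\|F\|^2=\frac12\sum_{j}\int_0^\infty\|\widehat F(\nu,j)\|_{\mathcal{B}_2}^2\frac{d\nu}{\nu}$.) -/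

import Mathlib

open MeasureTheory FourierTransform
open scoped ENNReal

noncomputable section

/-! ### Hilbert--Schmidt operators -/

section HilbertSchmidt

variable (H : Type*) [NormedAddCommGroup H] [InnerProductSpace ℂ H] [CompleteSpace H]

/-- The index set of a fixed orthonormal basis of `H`. -/
def onbIndex : Set H := (exists_hilbertBasis ℂ H).choose

/-- A fixed orthonormal basis of `H`; by `HS.tsum_basis_indep` below the
Hilbert--Schmidt operators and their norm do not depend on the choice. -/
def onb : HilbertBasis (onbIndex H) ℂ H := (exists_hilbertBasis ℂ H).choose_spec.choose

/-- The bounded operators `T` with `∑ i, ‖T e i‖ ^ 2 < ∞`. -/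
def hilbertSchmidt : Submodule ℂ (H →L[ℂ] H) where
  carrier := {T | Memℓp (fun i => T (onb H i)) 2}
  add_mem' hS hT := hS.add hT
  zero_mem' := zero_memℓp
  smul_mem' c _ hT := hT.const_smul c

/-- The space `𝓑₂(H)` of Hilbert--Schmidt operators on `H`. It carries the Hilbert--Schmidt norm,
not the operator norm. -/
def HS : Type _ := hilbertSchmidt H

namespace HS

variable {H}

instance : AddCommGroup (HS H) := inferInstanceAs (AddCommGroup (hilbertSchmidt H))
instance : Module ℂ (HS H) := inferInstanceAs (Module ℂ (hilbertSchmidt H))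

/-- The underlying bounded operator. -/
def toCLM : HS H →ₗ[ℂ] (H →L[ℂ] H) := (hilbertSchmidt H).subtype

/-- A bounded operator satisfying the Hilbert--Schmidt condition. -/
def mk (T : H →L[ℂ] H) (hT : T ∈ hilbertSchmidt H) : HS H := ⟨T, hT⟩

theorem toCLM_injective : Function.Injective (toCLM (H := H)) := Subtype.val_injective

/-- `T ↦ (T e i)_i`, a linear embedding into `ℓ²`. -/
def toℓ2 : HS H →ₗ[ℂ] lp (fun _ : onbIndex H => H) 2 where
  toFun T := ⟨fun i => toCLM T (onb H i), T.2⟩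
  map_add' _ _ := rfl
  map_smul' _ _ := rfl

theorem toℓ2_injective : Function.Injective (toℓ2 (H := H)) := by
  intro S T h
  apply toCLM_injective
  refine ContinuousLinearMap.ext_on
    (Submodule.dense_iff_topologicalClosure_eq_top.2 (onb H).dense_span) ?_
  rintro _ ⟨i, rfl⟩
  exact congrFun (congrArg Subtype.val h) i

/-- The inner product `⟪S, T⟫ = ∑ i, ⟪S e i, T e i⟫ = tr (T S^*)`. -/
@[reducible] def core : InnerProductSpace.Core ℂ (HS H) where
  inner S T := inner ℂ (toℓ2 S) (toℓ2 T)
  conj_inner_symm S T := inner_conj_symm _ _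
  re_inner_nonneg S := inner_self_nonneg
  add_left S T U := by simp
  smul_left S T c := by simp [mul_comm]
  definite S h := by
    apply toℓ2_injective
    simpa using inner_self_eq_zero.1 h

instance : NormedAddCommGroup (HS H) := core.toNormedAddCommGroup

instance : InnerProductSpace ℂ (HS H) := InnerProductSpace.ofCore core.toCore

theorem inner_eq (S T : HS H) :
    inner ℂ S T = ∑' i, inner ℂ (toCLM S (onb H i)) (toCLM T (onb H i)) :=
  lp.inner_eq_tsum (toℓ2 S) (toℓ2 T)

theorem norm_toℓ2 (T : HS H) : ‖toℓ2 T‖ = ‖T‖ := by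
  rw [@norm_eq_sqrt_re_inner ℂ _ _ _ _ (toℓ2 T), @norm_eq_sqrt_re_inner ℂ _ _ _ _ T]
  rfl

theorem summable_sq (T : HS H) : Summable fun i => ‖toCLM T (onb H i)‖ ^ 2 := by
  have := (memℓp_gen_iff (by norm_num)).1 T.2
  simp only [ENNReal.toReal_ofNat, Real.rpow_ofNat] at this
  exact this

theorem norm_sq_eq (T : HS H) : ‖T‖ ^ 2 = ∑' i, ‖toCLM T (onb H i)‖ ^ 2 := by
  rw [← norm_toℓ2]
  have := lp.norm_rpow_eq_tsum (p := 2) (by norm_num) (toℓ2 T)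
  simp only [ENNReal.toReal_ofNat, Real.rpow_ofNat] at this
  exact this

/-- Parseval's identity, with values in `[0, ∞]`. -/
theorem parseval {ι : Type*} (b : HilbertBasis ι ℂ H) (x : H) :
    ∑' i, ‖(inner ℂ (b i) x : ℂ)‖ₑ ^ 2 = ‖x‖ₑ ^ 2 := by
  have h1 := b.hasSum_inner_mul_inner x x
  have h2 : HasSum (fun i => ‖(inner ℂ (b i) x : ℂ)‖ ^ 2) (‖x‖ ^ 2) := by
    rw [← Complex.hasSum_ofReal]
    rw [inner_self_eq_norm_sq_to_K] at h1
    simp_rw [← inner_conj_symm x (b _), Complex.conj_mul'] at h1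
    simpa using h1
  have h3 : ∀ y : ℝ, 0 ≤ y → ENNReal.ofReal (y ^ 2) = ENNReal.ofReal y ^ 2 :=
    fun y hy => ENNReal.ofReal_pow hy 2
  simp_rw [← ofReal_norm, ← h3 _ (norm_nonneg _)]
  rw [← ENNReal.ofReal_tsum_of_nonneg (fun _ => by positivity) h2.summable, h2.tsum_eq]

theorem tsum_adjoint {ι κ : Type*} (b : HilbertBasis ι ℂ H) (c : HilbertBasis κ ℂ H)
    (T : H →L[ℂ] H) :
    ∑' i, ‖T (b i)‖ₑ ^ 2 = ∑' j, ‖ContinuousLinearMap.adjoint T (c j)‖ₑ ^ 2 := by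
  simp_rw [← parseval c (T (b _)), ← parseval b (ContinuousLinearMap.adjoint T (c _))]
  rw [ENNReal.tsum_comm]
  refine tsum_congr fun j => tsum_congr fun i => ?_
  rw [ContinuousLinearMap.adjoint_inner_right, ← ofReal_norm, ← ofReal_norm,
    norm_inner_symm]

/-- The Hilbert--Schmidt sum does not depend on the orthonormal basis. -/
theorem tsum_basis_indep {ι κ : Type*} (b : HilbertBasis ι ℂ H) (c : HilbertBasis κ ℂ H)
    (T : H →L[ℂ] H) : ∑' i, ‖T (b i)‖ₑ ^ 2 = ∑' j, ‖T (c j)‖ₑ ^ 2 :=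
  (tsum_adjoint b b T).trans (tsum_adjoint c b T).symm

theorem norm_apply_le (T : HS H) (x : H) : ‖toCLM T x‖ ≤ ‖T‖ * ‖x‖ := by
  have h0 : ∑' i, ‖toCLM T (onb H i)‖ₑ ^ 2 = ‖T‖ₑ ^ 2 := by
    simp_rw [← ofReal_norm, ← ENNReal.ofReal_pow (norm_nonneg _)]
    rw [norm_sq_eq, ENNReal.ofReal_tsum_of_nonneg (fun _ => by positivity) (summable_sq T)]
  have h2 : ∀ z, ‖ContinuousLinearMap.adjoint (toCLM T) z‖ₑ ^ 2 ≤ ‖T‖ₑ ^ 2 * ‖z‖ₑ ^ 2 := by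
    intro z
    rw [← parseval (onb H) (ContinuousLinearMap.adjoint (toCLM T) z), ← h0, ← ENNReal.tsum_mul_right]
    refine ENNReal.tsum_le_tsum fun i => ?_
    rw [ContinuousLinearMap.adjoint_inner_right, ← mul_pow]
    gcongr
    rw [← ofReal_norm, ← ofReal_norm, ← ofReal_norm, ← ENNReal.ofReal_mul (norm_nonneg _)]
    exact ENNReal.ofReal_le_ofReal (norm_inner_le_norm _ _)
  have h3 : ‖ContinuousLinearMap.adjoint (toCLM T)‖ ≤ ‖T‖ := by
    refine ContinuousLinearMap.opNorm_le_bound _ (norm_nonneg _) fun z => ?_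
    have := h2 z
    rw [← mul_pow] at this
    have := (ENNReal.pow_le_pow_left_iff (two_ne_zero)).1 this
    rwa [← ofReal_norm, ← ofReal_norm, ← ofReal_norm, ← ENNReal.ofReal_mul (norm_nonneg _),
      ENNReal.ofReal_le_ofReal_iff (by positivity)] at this
  rw [LinearIsometryEquiv.norm_map] at h3
  exact (toCLM T).le_of_opNorm_le h3 x

theorem norm_toCLM_le (T : HS H) : ‖toCLM T‖ ≤ ‖T‖ :=
  ContinuousLinearMap.opNorm_le_bound _ (norm_nonneg _) (norm_apply_le T)

instance : CompleteSpace (HS H) := by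
  refine Metric.complete_of_cauchySeq_tendsto fun u hu => ?_
  have hiso : ∀ S T : HS H, dist (toℓ2 S) (toℓ2 T) = dist S T := fun S T => by
    rw [dist_eq_norm, dist_eq_norm, ← map_sub, norm_toℓ2]
  have h1 : CauchySeq fun n => toℓ2 (u n) := by
    rw [Metric.cauchySeq_iff'] at hu ⊢
    simpa [hiso] using hu
  have h2 : CauchySeq fun n => toCLM (u n) := by
    rw [Metric.cauchySeq_iff'] at hu ⊢
    intro ε hε
    obtain ⟨N, hN⟩ := hu ε hε
    refine ⟨N, fun n hn => lt_of_le_of_lt ?_ (hN n hn)⟩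
    rw [dist_eq_norm, dist_eq_norm, ← map_sub]
    exact norm_toCLM_le _
  obtain ⟨x, hx⟩ := cauchySeq_tendsto_of_complete h1
  obtain ⟨T, hT⟩ := cauchySeq_tendsto_of_complete h2
  have h3 : ∀ i, x i = T (onb H i) := by
    intro i
    have ha : Filter.Tendsto (fun n => toCLM (u n) (onb H i)) Filter.atTop (nhds (x i)) := by
      rw [tendsto_iff_norm_sub_tendsto_zero] at hx ⊢
      refine squeeze_zero (fun _ => norm_nonneg _) (fun n => ?_) hx
      exact lp.norm_apply_le_norm two_ne_zero (toℓ2 (u n) - x) i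
    exact tendsto_nhds_unique ha
      (((ContinuousLinearMap.apply ℂ H (onb H i)).continuous.tendsto T).comp hT)
  have h4 : T ∈ hilbertSchmidt H := by
    change Memℓp (fun i => T (onb H i)) 2
    simp_rw [← h3]
    exact lp.memℓp x
  refine ⟨mk T h4, ?_⟩
  have h5 : toℓ2 (mk T h4) = x := by
    ext i
    exact (h3 i).symm
  rw [tendsto_iff_dist_tendsto_zero] at hx ⊢
  simpa only [← hiso, h5] using hx

/-- Composition `U ∘ T` of a bounded operator with a Hilbert--Schmidt operator. -/
def compLeft (U : H →L[ℂ] H) (T : HS H) : HS H :=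
  mk (U ∘L toCLM T) <| by
    refine memℓp_gen (((summable_sq T).mul_left (‖U‖ ^ 2)).of_nonneg_of_le
      (fun _ => by positivity) fun i => ?_)
    have := U.le_opNorm (toCLM T (onb H i))
    simp only [ENNReal.toReal_ofNat, Real.rpow_ofNat, ContinuousLinearMap.comp_apply]
    rw [← mul_pow]
    gcongr

theorem toCLM_compLeft (U : H →L[ℂ] H) (T : HS H) : toCLM (compLeft U T) = U ∘L toCLM T := rfl

theorem norm_compLeft (U : H →ₗᵢ[ℂ] H) (T : HS H) : ‖compLeft U.toContinuousLinearMap T‖ = ‖T‖ := by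
  rw [← sq_eq_sq₀ (norm_nonneg _) (norm_nonneg _), norm_sq_eq, norm_sq_eq]
  simp [toCLM_compLeft]

end HS

end HilbertSchmidt

/-! ### The Schrödinger representation -/

/-- `ℝⁿ` with its Euclidean structure. -/
abbrev Rn (n : ℕ) : Type := EuclideanSpace ℝ (Fin n)

/-- `L²(ℝⁿ)`. -/
abbrev L2Rn (n : ℕ) : Type := Lp ℂ 2 (volume : Measure (Rn n))

/-- `L²(ℝ²ⁿ) = L²(ℂⁿ)`, in the variables `(x, y)`. -/
abbrev L2R2n (n : ℕ) : Type := Lp ℂ 2 (volume : Measure (Rn n × Rn n))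

section Schrodinger

variable {n : ℕ}

/-- The phase `exp (2πiλ (t + x·ξ + x·y/2))`. -/
def schrodingerPhase (lam : ℝ) (x y : Rn n) (t : ℝ) (ξ : Rn n) : ℂ :=
  Complex.exp (2 * Real.pi * Complex.I *
    ((lam * (t + inner ℝ x ξ + inner ℝ x y / 2) : ℝ) : ℂ))

/-- `ξ ↦ exp (2πiλ (t + x·ξ + x·y/2)) φ(ξ + y)`. -/
def schrodingerFun (lam : ℝ) (x y : Rn n) (t : ℝ) (φ : Rn n → ℂ) (ξ : Rn n) : ℂ :=
  schrodingerPhase lam x y t ξ * φ (ξ + y)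

theorem norm_schrodingerPhase (lam : ℝ) (x y : Rn n) (t : ℝ) (ξ : Rn n) :
    ‖schrodingerPhase lam x y t ξ‖ = 1 := by
  rw [schrodingerPhase, show ∀ r : ℝ, 2 * (Real.pi : ℂ) * Complex.I * (r : ℂ)
    = ((2 * Real.pi * r : ℝ) : ℂ) * Complex.I by intro r; push_cast; ring]
  exact Complex.norm_exp_ofReal_mul_I _

theorem continuous_schrodingerPhase (x y : Rn n) (t : ℝ) :
    Continuous fun p : ℝ × Rn n => schrodingerPhase p.1 x y t p.2 := by
  unfold schrodingerPhase
  fun_prop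

theorem norm_schrodingerFun (lam : ℝ) (x y : Rn n) (t : ℝ) (φ : Rn n → ℂ) (ξ : Rn n) :
    ‖schrodingerFun lam x y t φ ξ‖ = ‖φ (ξ + y)‖ := by
  rw [schrodingerFun, norm_mul, norm_schrodingerPhase, one_mul]

theorem memLp_schrodingerFun (lam : ℝ) (x y : Rn n) (t : ℝ) {φ : Rn n → ℂ}
    (hφ : MemLp φ 2 volume) : MemLp (schrodingerFun lam x y t φ) 2 volume := by
  have h := hφ.comp_measurePreserving (measurePreserving_add_right volume y)
  refine (memLp_congr_norm ?_ h.1 (Filter.Eventually.of_forall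
    fun ξ => norm_schrodingerFun lam x y t φ ξ)).2 h
  have hc : Continuous (schrodingerPhase lam x y t) :=
    (continuous_schrodingerPhase x y t).comp (Continuous.prodMk_right lam)
  exact hc.aestronglyMeasurable.mul h.1

theorem schrodingerFun_congr (lam : ℝ) (x y : Rn n) (t : ℝ) {φ ψ : Rn n → ℂ}
    (h : φ =ᵐ[volume] ψ) :
    schrodingerFun lam x y t φ =ᵐ[volume] schrodingerFun lam x y t ψ := by
  have := (measurePreserving_add_right (volume : Measure (Rn n)) y).quasiMeasurePreserving.ae_eq h
  filter_upwards [this] with ξ hξ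
  simp only [Function.comp_apply] at hξ
  rw [schrodingerFun, schrodingerFun, hξ]

/-- The Schrödinger representation `π_λ(x, y, t)` of the Heisenberg group on `L²(ℝⁿ)`. -/
def schrodinger (lam : ℝ) (x y : Rn n) (t : ℝ) : L2Rn n →ₗᵢ[ℂ] L2Rn n where
  toFun φ := (memLp_schrodingerFun lam x y t (Lp.memLp φ)).toLp _
  map_add' φ ψ := by
    rw [← MemLp.toLp_add]
    refine MemLp.toLp_congr _ _ ((schrodingerFun_congr lam x y t (Lp.coeFn_add φ ψ)).trans ?_)
    refine Filter.Eventually.of_forall fun ξ => ?_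
    simp [schrodingerFun, mul_add]
  map_smul' c φ := by
    rw [RingHom.id_apply, ← MemLp.toLp_const_smul]
    refine MemLp.toLp_congr _ _ ((schrodingerFun_congr lam x y t (Lp.coeFn_smul c φ)).trans ?_)
    refine Filter.Eventually.of_forall fun ξ => ?_
    simp [schrodingerFun, mul_left_comm]
  norm_map' φ := by
    change ‖(memLp_schrodingerFun lam x y t (Lp.memLp φ)).toLp _‖ = ‖φ‖
    rw [Lp.norm_toLp, Lp.norm_def,
      ← eLpNorm_comp_measurePreserving (Lp.aestronglyMeasurable φ)
        (measurePreserving_add_right (volume : Measure (Rn n)) y)]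
    congr 1
    exact eLpNorm_congr_norm_ae (Filter.Eventually.of_forall
      fun ξ => norm_schrodingerFun lam x y t φ ξ)

theorem coeFn_schrodinger (lam : ℝ) (x y : Rn n) (t : ℝ) (φ : L2Rn n) :
    schrodinger lam x y t φ =ᵐ[volume] schrodingerFun lam x y t φ :=
  MemLp.coeFn_toLp (memLp_schrodingerFun lam x y t (Lp.memLp φ))

theorem continuous_schrodinger (x y : Rn n) (t : ℝ) (φ : L2Rn n) :
    Continuous fun lam => schrodinger lam x y t φ := by
  refine continuous_iff_continuousAt.2 fun lam₀ => ?_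
  have hm : ∀ lam, MemLp (fun ξ => schrodingerFun lam x y t φ ξ - schrodingerFun lam₀ x y t φ ξ) 2
      volume := fun lam =>
    (memLp_schrodingerFun lam x y t (Lp.memLp φ)).sub (memLp_schrodingerFun lam₀ x y t (Lp.memLp φ))
  rw [ContinuousAt, Lp.tendsto_Lp_iff_tendsto_eLpNorm']
  have h1 : ∀ lam, eLpNorm (⇑(schrodinger lam x y t φ) - ⇑(schrodinger lam₀ x y t φ)) 2 volume
      = (∫⁻ ξ, ‖schrodingerFun lam x y t φ ξ - schrodingerFun lam₀ x y t φ ξ‖ₑ ^ 2) ^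
        (1 / 2 : ℝ) := by
    intro lam
    rw [eLpNorm_congr_ae ((coeFn_schrodinger lam x y t φ).sub (coeFn_schrodinger lam₀ x y t φ)),
      eLpNorm_eq_lintegral_rpow_enorm_toReal (by norm_num) (by norm_num)]
    simp
  simp_rw [h1]
  have h2 : Filter.Tendsto (fun lam => ∫⁻ ξ, ‖schrodingerFun lam x y t φ ξ
      - schrodingerFun lam₀ x y t φ ξ‖ₑ ^ 2) (nhds lam₀) (nhds (∫⁻ _ : Rn n, 0)) := by
    have hφ : MemLp (fun ξ => φ (ξ + y)) 2 volume :=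
      (Lp.memLp φ).comp_measurePreserving (measurePreserving_add_right volume y)
    refine tendsto_lintegral_filter_of_dominated_convergence'
      (fun ξ => 4 * ‖φ (ξ + y)‖ₑ ^ 2) ?_ ?_ ?_ ?_
    · exact Filter.Eventually.of_forall fun lam => (hm lam).1.enorm.pow_const 2
    · refine Filter.Eventually.of_forall fun lam => Filter.Eventually.of_forall fun ξ => ?_
      have : ‖schrodingerFun lam x y t φ ξ - schrodingerFun lam₀ x y t φ ξ‖ₑ
          ≤ 2 * ‖φ (ξ + y)‖ₑ := by
        refine enorm_sub_le.trans ?_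
        rw [← ofReal_norm, ← ofReal_norm, norm_schrodingerFun, norm_schrodingerFun, ofReal_norm,
          two_mul]
      calc _ ≤ (2 * ‖φ (ξ + y)‖ₑ) ^ 2 := by gcongr
        _ = _ := by rw [mul_pow]; norm_num
    · have := hφ.2
      rw [eLpNorm_lt_top_iff_lintegral_rpow_enorm_lt_top (by norm_num) (by norm_num)] at this
      rw [lintegral_const_mul' _ _ (by norm_num)]
      refine ENNReal.mul_ne_top (by norm_num) ?_
      simpa using this.ne
    · refine Filter.Eventually.of_forall fun ξ => ?_
      have hc : Continuous fun lam => ‖schrodingerFun lam x y t φ ξ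
          - schrodingerFun lam₀ x y t φ ξ‖ₑ ^ 2 := by
        have : Continuous fun lam => schrodingerPhase lam x y t ξ :=
          (continuous_schrodingerPhase x y t).comp (Continuous.prodMk_left ξ)
        unfold schrodingerFun
        fun_prop
      simpa using hc.tendsto lam₀
  have h3 := (ENNReal.continuous_rpow_const (y := (1 / 2 : ℝ))).tendsto (∫⁻ _ : Rn n, 0)
  simpa [Function.comp_def] using h3.comp h2

theorem continuous_schrodinger_compLeft (x y : Rn n) (t : ℝ) :
    Continuous fun p : ℝ × HS (L2Rn n) =>
      HS.compLeft (schrodinger p.1 x y t).toContinuousLinearMap p.2 := by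
  have hsub : ∀ (U : L2Rn n →L[ℂ] L2Rn n) (S T : HS (L2Rn n)),
      HS.compLeft U S - HS.compLeft U T = HS.compLeft U (S - T) := by
    intro U S T
    apply HS.toCLM_injective
    simp [HS.toCLM_compLeft]
  refine continuous_prod_of_continuous_lipschitzWith' _ 1 (fun lam => ?_) (fun T => ?_)
  · refine LipschitzWith.of_dist_le_mul fun S T => ?_
    rw [dist_eq_norm, dist_eq_norm]
    simp only
    rw [hsub, HS.norm_compLeft]
    simp
  · refine continuous_iff_continuousAt.2 fun lam₀ => ?_
    rw [ContinuousAt, tendsto_iff_norm_sub_tendsto_zero]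
    have h1 : Filter.Tendsto (fun lam => ‖HS.compLeft (schrodinger lam x y t).toContinuousLinearMap T
        - HS.compLeft (schrodinger lam₀ x y t).toContinuousLinearMap T‖ ^ 2) (nhds lam₀)
        (nhds (∑' _ : onbIndex (L2Rn n), (0 : ℝ))) := by
      simp_rw [HS.norm_sq_eq]
      refine tendsto_tsum_of_dominated_convergence
        (bound := fun i => 4 * ‖HS.toCLM T (onb (L2Rn n) i)‖ ^ 2)
        ((HS.summable_sq T).mul_left 4) (fun i => ?_)
        (Filter.Eventually.of_forall fun lam i => ?_)
      · have hc : Continuous fun lam =>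
            ‖schrodinger lam x y t (HS.toCLM T (onb (L2Rn n) i))
              - schrodinger lam₀ x y t (HS.toCLM T (onb (L2Rn n) i))‖ ^ 2 := by
          have := continuous_schrodinger x y t (HS.toCLM T (onb (L2Rn n) i))
          fun_prop
        simpa [HS.toCLM_compLeft] using hc.tendsto lam₀
      · have h : ‖schrodinger lam x y t (HS.toCLM T (onb (L2Rn n) i))
              - schrodinger lam₀ x y t (HS.toCLM T (onb (L2Rn n) i))‖
              ≤ 2 * ‖HS.toCLM T (onb (L2Rn n) i)‖ := by
          refine (norm_sub_le _ _).trans ?_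
          rw [LinearIsometry.norm_map, LinearIsometry.norm_map, two_mul]
        have h' := pow_le_pow_left₀ (norm_nonneg _) h 2
        rw [mul_pow] at h'
        simp only [map_sub, HS.toCLM_compLeft, norm_pow, norm_norm]
        norm_num at h'
        exact h'
    have h2 := (Real.continuous_sqrt.tendsto _).comp h1
    simpa [Function.comp_def, Real.sqrt_sq] using h2

end Schrodinger

/-! ### The multiplicative group `ℝ^*` and the Gabor system -/

/-- The Haar measure `dκ(λ) = dλ/|λ|` of `ℝ^*`, as a measure on `ℝ` for which `{0}` is null. -/
def haarMul : Measure ℝ := volume.withDensity fun lam => ENNReal.ofReal |lam|⁻¹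

/-- Change of variables for the `κ`-measure of the image of a set. -/
theorem haarMul_image {s : Set ℝ} (hs : MeasurableSet s) {f f' : ℝ → ℝ}
    (hf : ∀ x, HasDerivAt f (f' x) x) (hinj : Function.Injective f)
    (hm : MeasurableSet (f '' s)) :
    haarMul (f '' s) = ∫⁻ x in s, ENNReal.ofReal |f' x| * ENNReal.ofReal |f x|⁻¹ := by
  rw [haarMul, withDensity_apply _ hm]
  exact lintegral_image_eq_lintegral_abs_deriv_mul hs (fun x _ => (hf x).hasDerivWithinAt)
    hinj.injOn _

theorem measurePreserving_div (ω : ℝˣ) :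
    MeasurePreserving (fun lam : ℝ => lam / ω) haarMul haarMul := by
  have hω : (ω : ℝ) ≠ 0 := ω.ne_zero
  have hmeas : Measurable fun lam : ℝ => lam / (ω : ℝ) := by fun_prop
  refine ⟨hmeas, ?_⟩
  ext s hs
  rw [Measure.map_apply hmeas hs]
  have himg : (fun lam : ℝ => lam / (ω : ℝ)) ⁻¹' s = (fun x => x * (ω : ℝ)) '' s := by
    ext u
    constructor
    · intro hu
      exact ⟨u / ω, hu, by field_simp⟩
    · rintro ⟨v, hv, rfl⟩
      simpa [hω] using hv
  rw [himg, haarMul_image hs (f' := fun _ => (ω : ℝ)) (fun x => by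
      simpa using (hasDerivAt_id x).mul_const (ω : ℝ)) (mul_left_injective₀ hω)
      (himg ▸ hmeas hs), haarMul, withDensity_apply _ hs]
  refine lintegral_congr fun x => ?_
  rw [← ENNReal.ofReal_mul (abs_nonneg _), abs_mul, mul_inv, mul_left_comm,
    mul_inv_cancel₀ (abs_ne_zero.2 hω), mul_one]

/-- `L²(ℝ^*, 𝓑₂; dκ)`. -/
abbrev L2HS (n : ℕ) : Type := Lp (HS (L2Rn n)) 2 haarMul

/-- The translation `(T_ω F)(λ) = F(λ/ω)` of `L²(ℝ^*, 𝓑₂; dκ)`. -/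
def translation {n : ℕ} (ω : ℝˣ) (F : L2HS n) : L2HS n :=
  Lp.compMeasurePreserving (fun lam : ℝ => lam / ω) (measurePreserving_div ω) F

theorem memLp_isometric {E : Type*} [NormedAddCommGroup E] {μ : Measure ℝ} (Φ : ℝ × E → E)
    (hΦ : Continuous Φ) (hn : ∀ r v, ‖Φ (r, v)‖ = ‖v‖) {F : ℝ → E} (hF : MemLp F 2 μ) :
    MemLp (fun r => Φ (r, F r)) 2 μ := by
  have h0 : AEStronglyMeasurable (fun r : ℝ => (r, F r)) μ :=
    AEStronglyMeasurable.prodMk measurable_id.aestronglyMeasurable hF.1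
  exact (memLp_congr_norm (hΦ.comp_aestronglyMeasurable h0) hF.1
    (Filter.Eventually.of_forall fun r => hn r (F r))).2 hF

theorem memLp_modulation {n : ℕ} (x y : Rn n) (t : ℝ) (F : L2HS n) :
    MemLp (fun lam => HS.compLeft (schrodinger lam x y t).toContinuousLinearMap (F lam)) 2
      haarMul :=
  memLp_isometric (fun p : ℝ × HS (L2Rn n) =>
      HS.compLeft (schrodinger p.1 x y t).toContinuousLinearMap p.2)
    (continuous_schrodinger_compLeft x y t) (fun r T => HS.norm_compLeft (schrodinger r x y t) T)
    (Lp.memLp F)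

/-- The modulation `(M_{(x,y,t)} F)(λ) = π_λ(x, y, t) F(λ)` of `L²(ℝ^*, 𝓑₂; dκ)`. -/
def modulation {n : ℕ} (x y : Rn n) (t : ℝ) (F : L2HS n) : L2HS n :=
  (memLp_modulation x y t F).toLp _

/-- The integer vector `k ∈ ℤⁿ` as an element of `ℝⁿ`. -/
def intVec {n : ℕ} (k : Fin n → ℤ) : Rn n := WithLp.toLp 2 fun i => (k i : ℝ)

/-- The index set `ℤ^{2n+1}` of the triples `(k, l, m)`. -/
abbrev GaborIdx (n : ℕ) : Type := (Fin n → ℤ) × (Fin n → ℤ) × ℤ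

/-- `M_{a(2k,l,m)} 𝒢` for `q = (k, l, m)`. -/
def modulated {n : ℕ} (a : ℝ) (G : L2HS n) (q : GaborIdx n) : L2HS n :=
  modulation ((2 * a) • intVec q.1) (a • intVec q.2.1) (a * (q.2.2 : ℝ)) G

/-- The Gabor system `T_{e^{bp}} M_{a(2k,l,m)} 𝒢`, indexed by `((k, l, m), p) ∈ ℤ^{2n+2}`. -/
def gaborSystem {n : ℕ} (a b : ℝ) (G : L2HS n) (i : GaborIdx n × ℤ) : L2HS n :=
  translation (Units.mk0 (Real.exp (b * (i.2 : ℝ))) (Real.exp_ne_zero _)) (modulated a G i.1)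

/-! ### The Fourier transform on `L²(ℝ^*, 𝓑₂; dκ)` -/

/-- The character `(ν, j)(λ) = exp (2πi log ν log |λ|) ς_j(λ/|λ|)` of `ℝ^*`, where `ς_1 = 1` and
`ς_{-1}(±1) = ±1`. -/
def groupChar (ν : ℝ) (j : ℤˣ) (lam : ℝ) : ℂ :=
  Complex.exp (2 * Real.pi * Complex.I * ((Real.log ν * Real.log |lam| : ℝ) : ℂ)) *
    (if 0 < lam then 1 else ((j : ℤ) : ℂ))

/-- The parametrization `u ↦ ε e^u` of a half line of `ℝ^*`. -/
def halfExp (ε : ℤˣ) (u : ℝ) : ℝ := ((ε : ℤ) : ℝ) * Real.exp u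

theorem halfExp_hasDerivAt (ε : ℤˣ) (u : ℝ) : HasDerivAt (halfExp ε) (halfExp ε u) u :=
  (Real.hasDerivAt_exp u).const_mul _

theorem halfExp_injective (ε : ℤˣ) : Function.Injective (halfExp ε) := by
  intro u v h
  rcases Int.units_eq_one_or ε with rfl | rfl <;> simpa [halfExp] using h

theorem measurableEmbedding_halfExp (ε : ℤˣ) : MeasurableEmbedding (halfExp ε) :=
  Continuous.measurableEmbedding
    (continuous_iff_continuousAt.2 fun u => (halfExp_hasDerivAt ε u).continuousAt)
    (halfExp_injective ε)

theorem halfExp_ne_zero (ε : ℤˣ) (u : ℝ) : halfExp ε u ≠ 0 := by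
  rcases Int.units_eq_one_or ε with rfl | rfl <;> simp [halfExp]

theorem measurePreserving_halfExp (ε : ℤˣ) :
    MeasurePreserving (halfExp ε) volume (haarMul.restrict (Set.range (halfExp ε))) := by
  have he := measurableEmbedding_halfExp ε
  refine ⟨he.measurable, ?_⟩
  ext s hs
  rw [Measure.map_apply he.measurable hs, Measure.restrict_apply hs,
    ← Set.image_preimage_eq_inter_range,
    haarMul_image (he.measurable hs) (halfExp_hasDerivAt ε) (halfExp_injective ε)
      (he.measurableSet_image.2 (he.measurable hs))]
  have : ∀ u, ENNReal.ofReal |halfExp ε u| * ENNReal.ofReal |halfExp ε u|⁻¹ = 1 := fun u => by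
    rw [← ENNReal.ofReal_mul (abs_nonneg _), mul_inv_cancel₀ (abs_ne_zero.2 (halfExp_ne_zero ε u)),
      ENNReal.ofReal_one]
  simp [this]

section Fourier

variable {E : Type*} [NormedAddCommGroup E] [InnerProductSpace ℂ E] [CompleteSpace E]

/-- The function `u ↦ F(ε e^u)` in `L²(ℝ)`. -/
def logPullback (ε : ℤˣ) (F : Lp E 2 haarMul) : Lp E 2 (volume : Measure ℝ) :=
  (((Lp.memLp F).restrict (Set.range (halfExp ε))).comp_measurePreserving
    (measurePreserving_halfExp ε)).toLp _

/-- The Fourier transform `F̂(ν, j) = ∫ conj ((ν, j)(λ)) F(λ) dκ(λ)` on `L²(ℝ^*, E; dκ)`. In the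
coordinates `λ = ± e^u` it is given by Mathlib's Fourier transform on `L²(ℝ)`; that it is the
integral above for `F ∈ L¹ ∩ L²` is `groupFourier_eq_integral`. -/
def groupFourier (F : Lp E 2 haarMul) (ν : ℝ) (j : ℤˣ) : E :=
  (𝓕 (logPullback 1 F) : Lp E 2 (volume : Measure ℝ)) (Real.log ν) +
    ((j : ℤ) : ℂ) • (𝓕 (logPullback (-1) F) : Lp E 2 (volume : Measure ℝ)) (Real.log ν)

theorem fourier_L2_eq_integral (f : Lp E 2 (volume : Measure ℝ)) (hf : Integrable f) :
    ∀ᵐ v, (𝓕 f : Lp E 2 (volume : Measure ℝ)) v = 𝓕 (f : ℝ → E) v := by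
  have hloc : LocallyIntegrable (𝓕 f : Lp E 2 (volume : Measure ℝ)) :=
    (Lp.memLp _).locallyIntegrable (by norm_num)
  have hcont : Continuous (𝓕 (f : ℝ → E)) := 
    VectorFourier.fourierIntegral_continuous Real.continuous_fourierChar continuous_inner hf
  have key : ∀ᵐ v, (𝓕 f : Lp E 2 (volume : Measure ℝ)) v - 𝓕 (f : ℝ → E) v = 0 := by
    refine ae_eq_zero_of_integral_contDiff_smul_eq_zero (hloc.sub hcont.locallyIntegrable) ?_
    intro g hg hgs
    have hgs' : HasCompactSupport fun x => (g x : ℂ) := hgs.comp_left Complex.ofReal_zero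
    have hg' : ContDiff ℝ (⊤ : ℕ∞) fun x => (g x : ℂ) := Complex.ofRealCLM.contDiff.comp hg
    let S : SchwartzMap ℝ ℂ := hgs'.toSchwartzMap hg'
    have hS : ∀ x, S x = (g x : ℂ) := fun x => rfl
    have h1 : ∫ x, S x • (𝓕 f : Lp E 2 (volume : Measure ℝ)) x = ∫ x, (𝓕 S) x • f x := by
      have := congrArg (fun T => T S) (Lp.fourier_toTemperedDistribution_eq f)
      simpa [TemperedDistribution.fourier_apply, Lp.toTemperedDistribution_apply] using this.symm
    have h2 : ∫ x, (𝓕 S) x • f x = ∫ x, S x • 𝓕 (f : ℝ → E) x := by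
      rw [SchwartzMap.fourier_coe]
      have := VectorFourier.integral_fourierIntegral_smul_eq_flip (L := innerₗ ℝ)
        (μ := volume) (ν := volume) Real.continuous_fourierChar continuous_inner
        (S.integrable (μ := volume)) hf
      rw [flip_innerₗ] at this
      exact this
    have hi1 : Integrable fun x => g x • (𝓕 f : Lp E 2 (volume : Measure ℝ)) x :=
      hloc.integrable_smul_left_of_hasCompactSupport hg.continuous hgs
    have hi2 : Integrable fun x => g x • 𝓕 (f : ℝ → E) x :=
      hcont.locallyIntegrable.integrable_smul_left_of_hasCompactSupport hg.continuous hgs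
    have h3 := h1.trans h2
    simp only [hS, Complex.coe_smul] at h3
    simp only [smul_sub]
    rw [integral_sub hi1 hi2, h3, sub_self]
  filter_upwards [key] with v hv using sub_eq_zero.1 hv

theorem groupFourier_eq_integral (F : Lp E 2 haarMul) (hF : Integrable F haarMul) (j : ℤˣ) :
    ∀ᵐ ν ∂(haarMul.restrict (Set.Ioi 0)),
      groupFourier F ν j = ∫ lam, (starRingEnd ℂ) (groupChar ν j lam) • F lam ∂haarMul := by
  have hr1 : Set.range (halfExp 1) = Set.Ioi 0 := by
    have : halfExp 1 = Real.exp := by ext; simp [halfExp]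
    rw [this, Real.range_exp]
  have hr2 : Set.range (halfExp (-1)) = Set.Iio 0 := by
    ext x
    constructor
    · rintro ⟨u, rfl⟩
      simp [halfExp, Real.exp_pos]
    · intro hx
      refine ⟨Real.log (-x), ?_⟩
      rw [halfExp, Real.exp_log (neg_pos.2 hx)]
      simp
  have hcoe : ∀ ε, logPullback ε F =ᵐ[volume] fun u => F (halfExp ε u) := fun ε =>
    MemLp.coeFn_toLp (((Lp.memLp F).restrict (Set.range (halfExp ε))).comp_measurePreserving
      (measurePreserving_halfExp ε))
  have hint : ∀ ε, Integrable (logPullback ε F) := fun ε => by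
    rw [integrable_congr (hcoe ε)]
    exact ((measurePreserving_halfExp ε).integrable_comp_emb (measurableEmbedding_halfExp ε)).2
      hF.integrableOn
  have hfour : ∀ ε v, 𝓕 (logPullback ε F : ℝ → E) v
      = ∫ u, Complex.exp (-(2 * Real.pi * Complex.I * ((v * u : ℝ) : ℂ))) • F (halfExp ε u) := by
    intro ε v
    rw [Real.fourier_real_eq_integral_exp_smul]
    refine integral_congr_ae ?_
    filter_upwards [hcoe ε] with u hu
    rw [hu]
    congr 2
    push_cast
    ring
  rw [← hr1, ← (measurePreserving_halfExp 1).map_eq,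
    (measurableEmbedding_halfExp 1).ae_map_iff]
  filter_upwards [fourier_L2_eq_integral _ (hint 1), fourier_L2_eq_integral _ (hint (-1))]
    with v hv1 hv2
  have hlog : Real.log (halfExp 1 v) = v := by simp [halfExp]
  have hnull : haarMul {0} = 0 := by
    rw [haarMul, withDensity_apply _ (measurableSet_singleton 0)]
    simp
  have hbdd : ∀ ν lam, ‖(starRingEnd ℂ) (groupChar ν j lam)‖ ≤ 1 := by
    intro ν lam
    rw [RCLike.norm_conj, groupChar, norm_mul,
      show ∀ r : ℝ, 2 * (Real.pi : ℂ) * Complex.I * (r : ℂ)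
        = ((2 * Real.pi * r : ℝ) : ℂ) * Complex.I by intro r; push_cast; ring,
      Complex.norm_exp_ofReal_mul_I, one_mul]
    rcases Int.units_eq_one_or j with rfl | rfl <;> split_ifs <;> simp
  have hmeas : ∀ ν, Measurable fun lam => (starRingEnd ℂ) (groupChar ν j lam) := by
    intro ν
    unfold groupChar
    refine Complex.continuous_conj.measurable.comp (Measurable.mul (by fun_prop) ?_)
    exact Measurable.ite measurableSet_Ioi measurable_const measurable_const
  have hI : Integrable (fun lam => (starRingEnd ℂ) (groupChar (halfExp 1 v) j lam) • F lam)
      haarMul := by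
    refine hF.bdd_smul 1 (hmeas _).aestronglyMeasurable (Filter.Eventually.of_forall (hbdd _))
  have hsplit := integral_add_compl (measurableSet_Ioi (a := (0 : ℝ))) hI
  rw [Set.compl_Ioi, setIntegral_congr_set (Iio_ae_eq_Iic' hnull).symm] at hsplit
  rw [← hsplit, ← hr1, ← hr2, ← (measurePreserving_halfExp 1).integral_comp
    (measurableEmbedding_halfExp 1), ← (measurePreserving_halfExp (-1)).integral_comp
    (measurableEmbedding_halfExp (-1)), groupFourier, hlog, hv1, hv2, hfour, hfour]
  congr 1
  · refine integral_congr_ae (Filter.Eventually.of_forall fun u => ?_)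
    have hpos : 0 < halfExp 1 u := by simp [halfExp, Real.exp_pos]
    simp only [groupChar, hlog, hpos, if_true, mul_one]
    rw [← Complex.exp_conj]
    congr 2
    simp [halfExp, map_ofNat]
  · rw [← integral_smul]
    refine integral_congr_ae (Filter.Eventually.of_forall fun u => ?_)
    have hneg : ¬ 0 < halfExp (-1) u := by simp [halfExp, Real.exp_nonneg]
    simp only [groupChar, hlog, hneg, if_false, map_mul]
    rw [← Complex.exp_conj, smul_smul, mul_comm]
    congr 2
    · congr 1
      simp [halfExp, map_ofNat]
    · simp

end Fourier

/-! ### The Weyl transform -/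

section Gabor

variable {n : ℕ}

/-- `T = W(g)`, where `W(g)φ = ∫ g(x, y) π(x, y) φ dx dy` is the Weyl transform and
`π(x, y) = π_1(x, y, 0)`. For `g ∈ L²(ℝ²ⁿ)` the integral is understood weakly; its integrand below
is integrable as `(x, y) ↦ ⟪ψ, π(x, y) φ⟫` is in `L²(ℝ²ⁿ)`. -/
def IsWeylTransform (g : L2R2n n) (T : HS (L2Rn n)) : Prop :=
  ∀ φ ψ : L2Rn n,
    inner ℂ ψ (HS.toCLM T φ) = ∫ z : Rn n × Rn n, g z * inner ℂ ψ (schrodinger 1 z.1 z.2 0 φ)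

/-- The inverse Weyl transform `W⁻¹(T)`: the function `g ∈ L²(ℝ²ⁿ)` with `W(g) = T`, which exists
and is unique as `W` is an isometric isomorphism of `L²(ℝ²ⁿ)` onto `𝓑₂`. -/
def weylInverse (T : HS (L2Rn n)) : L2R2n n := Classical.epsilon fun g => IsWeylTransform g T

/-- The function `g_{k,l,m}(·, ν, j) ∈ L²(ℂⁿ)` with `W(g_{k,l,m}(·, ν, j)) = 𝒢̂_{k,l,m}(ν, j)`,
where `𝒢_{k,l,m} = M_{a(2k,l,m)} 𝒢` and `q = (k, l, m)`. -/
def gaborSymbol (a : ℝ) (G : L2HS n) (q : GaborIdx n) (ν : ℝ) (j : ℤˣ) : L2R2n n :=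
  weylInverse (groupFourier (modulated a G q) ν j)

/-- `w_{g_{k,l,m}}(ν) = ∑ j, ∑ s, ‖g_{k,l,m}(·, ν e^{s/b}, j)‖²`, with values in `[0, ∞]`. -/
def gaborWeight (a b : ℝ) (G : L2HS n) (q : GaborIdx n) (ν : ℝ) : ℝ≥0∞ :=
  ∑ j : ℤˣ, ∑' s : ℤ, ‖gaborSymbol a G q (ν * Real.exp (s / b)) j‖ₑ ^ 2

/-- For almost every `ν ∈ (1, e^{1/b})` and all `j`, `s`, the functions
`g_{k,l,m}(·, ν e^{s/b}, j)`, `(k, l, m) ∈ ℤ^{2n+1}`, form an orthogonal system in `L²(ℂⁿ)`. -/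
def OrthogonalSymbols (a b : ℝ) (G : L2HS n) : Prop :=
  ∀ (j : ℤˣ) (s : ℤ), ∀ᵐ ν ∂(volume.restrict (Set.Ioo 1 (Real.exp (1 / b)))),
    ∀ q q' : GaborIdx n, q ≠ q' →
      inner ℂ (gaborSymbol a G q (ν * Real.exp (s / b)) j)
        (gaborSymbol a G q' (ν * Real.exp (s / b)) j) = 0

/-- For almost every `ν ∈ (1, e^{1/b})` the sequences `(g_{k,l,m}(·, ν e^{s/b}, j))_{j,s}`,
`(k, l, m) ∈ ℤ^{2n+1}`, are orthogonal in `ℓ²({1,-1} × ℤ, L²(ℂⁿ))`. -/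
def FibrewiseOrthogonalSymbols (a b : ℝ) (G : L2HS n) : Prop :=
  ∀ᵐ ν ∂(volume.restrict (Set.Ioo 1 (Real.exp (1 / b)))),
    ∀ q q' : GaborIdx n, q ≠ q' →
      ∑ j : ℤˣ, ∑' s : ℤ, inner ℂ (gaborSymbol a G q (ν * Real.exp (s / b)) j)
        (gaborSymbol a G q' (ν * Real.exp (s / b)) j) = 0

/-- `OrthogonalSymbols` is the stronger of the two conditions. -/
theorem OrthogonalSymbols.fibrewise {a b : ℝ} {G : L2HS n} (h : OrthogonalSymbols a b G) :
    FibrewiseOrthogonalSymbols a b G := by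
  have h' := ae_all_iff.2 fun j => ae_all_iff.2 (h j)
  filter_upwards [h'] with ν hν q q' hq
  simp [hν _ _ q q' hq]

end Gabor

/-! ### Riesz sequences -/

section Riesz

variable {ι 𝓗 : Type*} [NormedAddCommGroup 𝓗] [InnerProductSpace ℂ 𝓗]

/-- `f` is a Riesz sequence: on `P`, the closed span of `f`, there are an orthonormal basis `e` and
a bounded invertible operator `U` with `f i = U (e i)`. -/
def IsRieszSequence (f : ι → 𝓗) : Prop :=
  ∃ (e : HilbertBasis ι ℂ (Submodule.span ℂ (Set.range f)).topologicalClosure)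
    (U : (Submodule.span ℂ (Set.range f)).topologicalClosure ≃L[ℂ]
      (Submodule.span ℂ (Set.range f)).topologicalClosure),
    ∀ i, (U (e i) : 𝓗) = f i

/-- `f` is a Riesz sequence with bounds `A` and `B`:
`A ∑ |c i|² ≤ ‖∑ c i f i‖² ≤ B ∑ |c i|²` for the finite (equivalently, all square summable)
sequences of scalars. -/
def IsRieszSequenceWithBounds (f : ι → 𝓗) (A B : ℝ) : Prop :=
  IsRieszSequence f ∧ ∀ c : ι →₀ ℂ,
    A * (c.sum fun _ z => ‖z‖ ^ 2) ≤ ‖c.sum fun i z => z • f i‖ ^ 2 ∧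
      ‖c.sum fun i z => z • f i‖ ^ 2 ≤ B * (c.sum fun _ z => ‖z‖ ^ 2)

end Riesz

end

/-! ### Plancherel's theorem on `L¹ ∩ L²` and injectivity of the Fourier transform -/

section Plancherel

variable {V E : Type*} [NormedAddCommGroup V] [InnerProductSpace ℝ V] [FiniteDimensional ℝ V]
  [MeasurableSpace V] [BorelSpace V] [NormedAddCommGroup E] [InnerProductSpace ℂ E]
  [CompleteSpace E]

/-! In the coordinates `λ = ±e^u` the measure `κ` is Lebesgue measure on two lines, and the Fourier
transform of `ℝ^*` at `(e^v, j)` is `P(v) + j Q(v)`, where `P` and `Q` are the Fourier transforms of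
the two halves. Summing over `j = ±1` removes the cross terms and doubles the rest, hence the factor
`1/2` in Plancherel's formula (`inner_eq_half_sum_groupFourierL2`). The operator `T_{e^{bp}}`
becomes multiplication by `exp(-2πi b p v)`, which has period `1/b`, so inner products in the Gabor
system are integrals over `(0, 1/b)` of a character times a sum over `j` and `s`.

Part (2). The Weyl transform is unitary (`inner_weylInverse`): the matrix coefficients of an
orthonormal basis form an orthonormal basis of `L²(ℝ²ⁿ)`. The symbols may therefore be replaced by
the Hilbert--Schmidt operators themselves. Fibrewise orthogonality makes the blocks with different
`(k,l,m)` orthogonal (`inner_gaborSystem_eq_zero`), so the bounds can be checked on one block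
(`bounds_iff`). There the squared norm of a combination with coefficients `c` is `1/2 ∫ |P_c|² w`
over `(0, 1/b)`, with `P_c` the trigonometric polynomial of `c`
(`lintegral_trigPoly_mul_logWeight`), while `∑ |c_p|² = b ∫ |P_c|²` (`lintegral_trigPoly`).
Trigonometric polynomials are dense in `L²` of any finite measure on the circle, so these
inequalities for all `c` amount to `2Ab ≤ w ≤ 2Bb` almost everywhere (`ae_le_of_forall_trigPoly`).
The bounds alone give the Riesz property (`isRieszSequence_of_bounds`).

Part (1). Pointwise orthogonality persists under every dilation `T_{e^t}`, which acts by scalars on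
the Fourier side. Central modulations multiply by characters `exp(2πi a m λ)`, and for `m' = m e^t`
the characters of `M_m 𝒢` and `T_{e^t} M_{m'} 𝒢` cancel, so `⟪𝒢, T_{e^t} 𝒢⟫ = 0`. Ratios `m'/m` of
distinct integers tending to `1` give `𝒢 = 0` (`OrthogonalSymbols.eq_zero`), and then both sides of
the equivalence fail. -/

theorem integral_fourier_smul_eq_integral_smul_fourier (S : SchwartzMap V ℂ) {f : V → E}
    (hf : Integrable f) : ∫ x, (𝓕 S) x • f x = ∫ x, S x • 𝓕 f x := by
  rw [SchwartzMap.fourier_coe]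
  have := VectorFourier.integral_fourierIntegral_smul_eq_flip (L := innerₗ V)
    (μ := volume) (ν := volume) Real.continuous_fourierChar continuous_inner
    (S.integrable (μ := volume)) hf
  rw [flip_innerₗ] at this
  exact this

theorem continuous_fourier_of_integrable {f : V → E} (hf : Integrable f) : Continuous (𝓕 f) :=
  VectorFourier.fourierIntegral_continuous Real.continuous_fourierChar continuous_inner hf

/-- Compactly supported smooth functions are Schwartz functions, so the fundamental lemma of the
calculus of variations applies. -/
theorem ae_eq_zero_of_forall_schwartz {f : V → E} (hf : LocallyIntegrable f)
    (h : ∀ S : SchwartzMap V ℂ, ∫ x, S x • f x = 0) : ∀ᵐ x, f x = 0 := by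
  refine ae_eq_zero_of_integral_contDiff_smul_eq_zero hf fun g hg hgs => ?_
  have hgs' : HasCompactSupport fun x => (g x : ℂ) := hgs.comp_left Complex.ofReal_zero
  have hg' : ContDiff ℝ (⊤ : ℕ∞) fun x => (g x : ℂ) := Complex.ofRealCLM.contDiff.comp hg
  have h1 := h (hgs'.toSchwartzMap hg')
  have h2 : ∀ x, (hgs'.toSchwartzMap hg') x = (g x : ℂ) := fun x => rfl
  simpa only [h2, Complex.coe_smul] using h1

/-- An integrable function with vanishing Fourier transform vanishes almost everywhere. -/
theorem ae_eq_zero_of_fourier_eq_zero {f : V → E} (hf : Integrable f) (h : ∀ w, 𝓕 f w = 0) :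
    ∀ᵐ x, f x = 0 := by
  refine ae_eq_zero_of_forall_schwartz hf.locallyIntegrable fun S => ?_
  -- Every Schwartz function `S` is the Fourier transform of `𝓕⁻ S`, so the multiplication formula
  -- reaches all test functions.
  have := integral_fourier_smul_eq_integral_smul_fourier (𝓕⁻ S) hf
  simpa [h, FourierTransform.fourier_fourierInv_eq] using this

/-- On `L¹ ∩ L²` the Fourier transform of `L²` is given by the Fourier integral. -/
theorem coeFn_fourier_ae_eq (f : Lp E 2 (volume : Measure V)) (hf : Integrable f) :
    (𝓕 f : Lp E 2 (volume : Measure V)) =ᵐ[volume] 𝓕 (f : V → E) := by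
  have hloc : LocallyIntegrable (𝓕 f : Lp E 2 (volume : Measure V)) :=
    (Lp.memLp _).locallyIntegrable (by norm_num)
  have hcont := continuous_fourier_of_integrable hf
  have key : ∀ᵐ v, (𝓕 f : Lp E 2 (volume : Measure V)) v - 𝓕 (f : V → E) v = 0 := by
    refine ae_eq_zero_of_integral_contDiff_smul_eq_zero (hloc.sub hcont.locallyIntegrable) ?_
    intro g hg hgs
    have hgs' : HasCompactSupport fun x => (g x : ℂ) := hgs.comp_left Complex.ofReal_zero
    have hg' : ContDiff ℝ (⊤ : ℕ∞) fun x => (g x : ℂ) := Complex.ofRealCLM.contDiff.comp hg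
    let S : SchwartzMap V ℂ := hgs'.toSchwartzMap hg'
    have hS : ∀ x, S x = (g x : ℂ) := fun x => rfl
    -- The two transforms agree as tempered distributions: each passes to the test function.
    have h1 : ∫ x, S x • (𝓕 f : Lp E 2 (volume : Measure V)) x = ∫ x, (𝓕 S) x • f x := by
      have := congrArg (fun T => T S) (Lp.fourier_toTemperedDistribution_eq f)
      simpa [TemperedDistribution.fourier_apply, Lp.toTemperedDistribution_apply] using this.symm
    have hi1 : Integrable fun x => g x • (𝓕 f : Lp E 2 (volume : Measure V)) x :=
      hloc.integrable_smul_left_of_hasCompactSupport hg.continuous hgs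
    have hi2 : Integrable fun x => g x • 𝓕 (f : V → E) x :=
      hcont.locallyIntegrable.integrable_smul_left_of_hasCompactSupport hg.continuous hgs
    have h3 := h1.trans (integral_fourier_smul_eq_integral_smul_fourier S hf)
    simp only [hS, Complex.coe_smul] at h3
    simp only [smul_sub]
    rw [integral_sub hi1 hi2, h3, sub_self]
  filter_upwards [key] with v hv using sub_eq_zero.1 hv

theorem fourier_toLp_ae_eq {f : V → E} (hf : Integrable f) (hf' : MemLp f 2) :
    (𝓕 (hf'.toLp f) : Lp E 2 (volume : Measure V)) =ᵐ[volume] 𝓕 f := by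
  have h := hf'.coeFn_toLp
  refine (coeFn_fourier_ae_eq _ ((integrable_congr h).2 hf)).trans
    (Filter.Eventually.of_forall fun v => ?_)
  rw [Real.fourier_eq, Real.fourier_eq]
  refine integral_congr_ae ?_
  filter_upwards [h] with u hu
  rw [hu]

theorem integral_inner_fourier {f g : V → E} (hf : Integrable f) (hf' : MemLp f 2)
    (hg : Integrable g) (hg' : MemLp g 2) :
    ∫ v, inner ℂ (𝓕 f v) (𝓕 g v) = ∫ x, inner ℂ (f x) (g x) := by
  have h := Lp.inner_fourier_eq (hf'.toLp f) (hg'.toLp g)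
  rw [L2.inner_def, L2.inner_def] at h
  calc _ = _ := integral_congr_ae ?_
    _ = _ := h
    _ = _ := integral_congr_ae ?_
  · filter_upwards [fourier_toLp_ae_eq hf hf', fourier_toLp_ae_eq hg hg'] with v h1 h2
    rw [h1, h2]
  · filter_upwards [hf'.coeFn_toLp, hg'.coeFn_toLp] with v h1 h2
    rw [h1, h2]

theorem lintegral_enorm_sq_coeFn {X F : Type*} [MeasurableSpace X] {μ : Measure X}
    [NormedAddCommGroup F] (f : Lp F 2 μ) : ∫⁻ x, ‖f x‖ₑ ^ 2 ∂μ = ‖f‖ₑ ^ 2 := by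
  have h : ‖f‖ₑ = eLpNorm f 2 μ := by
    rw [Lp.enorm_def]
  rw [h, eLpNorm_eq_lintegral_rpow_enorm_toReal (by norm_num) (by norm_num), ← ENNReal.rpow_natCast,
    ← ENNReal.rpow_mul]
  simp

theorem lintegral_enorm_fourier_sq {f : V → E} (hf : Integrable f) (hf' : MemLp f 2) :
    ∫⁻ v, ‖𝓕 f v‖ₑ ^ 2 = ∫⁻ x, ‖f x‖ₑ ^ 2 := by
  calc _ = ∫⁻ v, ‖(𝓕 (hf'.toLp f) : Lp E 2 (volume : Measure V)) v‖ₑ ^ 2 :=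
        lintegral_congr_ae ?_
    _ = ∫⁻ x, ‖hf'.toLp f x‖ₑ ^ 2 := by
        rw [lintegral_enorm_sq_coeFn, lintegral_enorm_sq_coeFn, ← ofReal_norm,
          Lp.norm_fourier_eq, ofReal_norm]
    _ = _ := lintegral_congr_ae ?_
  · filter_upwards [fourier_toLp_ae_eq hf hf'] with v h1
    rw [h1]
  · filter_upwards [hf'.coeFn_toLp] with v h1
    rw [h1]

end Plancherel

/-! ### Matrix coefficients of the Schrödinger representation -/

section MatrixCoefficients

variable {n : ℕ}

/-- The matrix coefficient `z ↦ ⟪π(z) φ, ψ⟫` of the Schrödinger representation. -/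
noncomputable def matrixCoeff (φ ψ : L2Rn n) (z : Rn n × Rn n) : ℂ :=
  inner ℂ (schrodinger 1 z.1 z.2 0 φ) ψ

/-- The function `ξ ↦ conj (φ (ξ + y)) ψ (ξ)`. -/
noncomputable def shiftProd (φ ψ : L2Rn n) (y ξ : Rn n) : ℂ :=
  (starRingEnd ℂ) (φ (ξ + y)) * ψ ξ

theorem measurable_shiftProd (φ ψ : L2Rn n) :
    Measurable fun p : Rn n × Rn n => shiftProd φ ψ p.1 p.2 := by
  have h1 := (Lp.stronglyMeasurable φ).measurable
  have h2 := (Lp.stronglyMeasurable ψ).measurable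
  unfold shiftProd
  exact (Complex.continuous_conj.measurable.comp (h1.comp (by fun_prop))).mul (h2.comp (by fun_prop))

theorem memLp_shift (φ : L2Rn n) (y : Rn n) : MemLp (fun ξ => φ (ξ + y)) 2 :=
  (Lp.memLp φ).comp_measurePreserving (measurePreserving_add_right volume y)

theorem integrable_shiftProd (φ ψ : L2Rn n) (y : Rn n) : Integrable (shiftProd φ ψ y) :=
  ((memLp_shift φ y).star).integrable_mul (Lp.memLp ψ)

theorem lintegral_shift_mul {u v : Rn n → ℝ≥0∞} (hu : Measurable u) (hv : Measurable v) :
    ∫⁻ y, ∫⁻ ξ, u (ξ + y) * v ξ = (∫⁻ η, u η) * ∫⁻ ξ, v ξ := by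
  rw [lintegral_lintegral_swap (by fun_prop)]
  have h : ∀ ξ, ∫⁻ y, u (ξ + y) * v ξ = (∫⁻ η, u η) * v ξ := fun ξ => by
    rw [lintegral_mul_const _ (by fun_prop), lintegral_add_left_eq_self]
  simp_rw [h]
  rw [lintegral_const_mul _ hv]

theorem lintegral_shiftProd (φ ψ : L2Rn n) :
    ∫⁻ y, ∫⁻ ξ, ‖shiftProd φ ψ y ξ‖ₑ ^ 2 = ‖φ‖ₑ ^ 2 * ‖ψ‖ₑ ^ 2 := by
  have h1 := (Lp.stronglyMeasurable φ).measurable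
  have h2 := (Lp.stronglyMeasurable ψ).measurable
  have h := lintegral_shift_mul (u := fun ξ => ‖φ ξ‖ₑ ^ 2) (v := fun ξ => ‖ψ ξ‖ₑ ^ 2)
    (by fun_prop) (by fun_prop)
  rw [lintegral_enorm_sq_coeFn, lintegral_enorm_sq_coeFn] at h
  rw [← h]
  refine lintegral_congr fun y => lintegral_congr fun ξ => ?_
  rw [shiftProd, enorm_mul, RCLike.enorm_conj, mul_pow]

theorem memLp_two_of_lintegral_enorm_sq_lt_top {X F : Type*} [MeasurableSpace X] {μ : Measure X}
    [NormedAddCommGroup F] {f : X → F} (hf : AEStronglyMeasurable f μ)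
    (h : ∫⁻ x, ‖f x‖ₑ ^ 2 ∂μ < ∞) : MemLp f 2 μ := by
  refine ⟨hf, ?_⟩
  rw [eLpNorm_lt_top_iff_lintegral_rpow_enorm_lt_top (by norm_num) (by norm_num)]
  simpa using h

/-- For a fixed `y` a product of two `L²` functions is only integrable. Square integrability holds
for almost every `y`, because the double integral of the square is finite; this is what permits
Plancherel in the variable `x`. -/
theorem ae_memLp_shiftProd (φ ψ : L2Rn n) : ∀ᵐ y, MemLp (shiftProd φ ψ y) 2 := by
  have hm := measurable_shiftProd φ ψ
  have h1 : ∀ᵐ y, ∫⁻ ξ, ‖shiftProd φ ψ y ξ‖ₑ ^ 2 < ∞ := by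
    refine ae_lt_top ?_ ?_
    · exact Measurable.lintegral_prod_right' (hm.enorm.pow_const 2)
    · rw [lintegral_shiftProd]
      exact (ENNReal.mul_lt_top (by simp) (by simp)).ne
  filter_upwards [h1] with y hy
  exact memLp_two_of_lintegral_enorm_sq_lt_top (integrable_shiftProd φ ψ y).1 hy

/-- For fixed `y` the coefficient is, up to a unimodular factor, a Fourier transform in `x`. This
reduces the orthogonality relations to Plancherel's theorem. -/
theorem matrixCoeff_eq (φ ψ : L2Rn n) (z : Rn n × Rn n) :
    matrixCoeff φ ψ z = Complex.exp (-(2 * Real.pi * Complex.I *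
      ((inner ℝ z.1 z.2 / 2 : ℝ) : ℂ))) * 𝓕 (shiftProd φ ψ z.2) z.1 := by
  rw [matrixCoeff, L2.inner_def, Real.fourier_eq', ← integral_const_mul]
  refine integral_congr_ae ?_
  filter_upwards [coeFn_schrodinger 1 z.1 z.2 0 φ] with ξ hξ
  have hph : (starRingEnd ℂ) (schrodingerPhase 1 z.1 z.2 0 ξ) = Complex.exp (-(2 * Real.pi *
      Complex.I * ((inner ℝ z.1 z.2 / 2 : ℝ) : ℂ))) *
        Complex.exp (((-2 * Real.pi * inner ℝ ξ z.1 : ℝ) : ℂ) * Complex.I) := by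
    rw [schrodingerPhase, ← Complex.exp_conj, ← Complex.exp_add, real_inner_comm]
    congr 1
    simp only [map_mul, Complex.conj_I, Complex.conj_ofReal, map_ofNat]
    push_cast
    ring
  rw [hξ, RCLike.inner_apply, schrodingerFun, map_mul, hph, shiftProd, smul_eq_mul]
  ring

theorem norm_phase (r : ℝ) : ‖Complex.exp (-(2 * Real.pi * Complex.I * (r : ℂ)))‖ = 1 := by
  rw [show -(2 * (Real.pi : ℂ) * Complex.I * (r : ℂ)) = ((-(2 * Real.pi * r) : ℝ) : ℂ) * Complex.I by
    push_cast; ring]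
  exact Complex.norm_exp_ofReal_mul_I _

theorem enorm_matrixCoeff (φ ψ : L2Rn n) (z : Rn n × Rn n) :
    ‖matrixCoeff φ ψ z‖ₑ = ‖𝓕 (shiftProd φ ψ z.2) z.1‖ₑ := by
  rw [matrixCoeff_eq, enorm_mul, ← ofReal_norm, norm_phase, ENNReal.ofReal_one, one_mul]

theorem stronglyMeasurable_matrixCoeff (φ ψ : L2Rn n) : StronglyMeasurable (matrixCoeff φ ψ) := by
  have h : matrixCoeff φ ψ = fun z : Rn n × Rn n => Complex.exp (-(2 * Real.pi * Complex.I *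
      ((inner ℝ z.1 z.2 / 2 : ℝ) : ℂ))) * ∫ ξ : Rn n,
        Complex.exp (((-2 * Real.pi * inner ℝ ξ z.1 : ℝ) : ℂ) * Complex.I) • shiftProd φ ψ z.2 ξ := by
    ext z
    rw [matrixCoeff_eq, Real.fourier_eq']
  rw [h]
  refine StronglyMeasurable.mul (Continuous.stronglyMeasurable (by fun_prop)) ?_
  have hm := measurable_shiftProd φ ψ
  refine StronglyMeasurable.integral_prod_right'
    (f := fun p : (Rn n × Rn n) × Rn n =>
      Complex.exp (((-2 * Real.pi * inner ℝ p.2 p.1.1 : ℝ) : ℂ) * Complex.I) • shiftProd φ ψ p.1.2 p.2) ?_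
  have hc : Continuous fun p : (Rn n × Rn n) × Rn n =>
      Complex.exp (((-2 * Real.pi * inner ℝ p.2 p.1.1 : ℝ) : ℂ) * Complex.I) := by fun_prop
  refine Measurable.stronglyMeasurable (hc.measurable.smul ?_)
  exact hm.comp (g := fun p : Rn n × Rn n => shiftProd φ ψ p.1 p.2)
    (f := fun p : (Rn n × Rn n) × Rn n => (p.1.2, p.2)) (by fun_prop)

/-- Plancherel in `x` for almost every `y`, followed by integration over `y`. -/
theorem lintegral_matrixCoeff (φ ψ : L2Rn n) :
    ∫⁻ z, ‖matrixCoeff φ ψ z‖ₑ ^ 2 = ‖φ‖ₑ ^ 2 * ‖ψ‖ₑ ^ 2 := by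
  have hm := (stronglyMeasurable_matrixCoeff φ ψ).measurable
  rw [Measure.volume_eq_prod, lintegral_prod_symm _ (by fun_prop), ← lintegral_shiftProd]
  refine lintegral_congr_ae ?_
  filter_upwards [ae_memLp_shiftProd φ ψ] with y hy
  simp_rw [enorm_matrixCoeff]
  exact lintegral_enorm_fourier_sq (integrable_shiftProd φ ψ y) hy

theorem memLp_matrixCoeff (φ ψ : L2Rn n) : MemLp (matrixCoeff φ ψ) 2 := by
  refine memLp_two_of_lintegral_enorm_sq_lt_top
    (stronglyMeasurable_matrixCoeff φ ψ).aestronglyMeasurable ?_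
  rw [lintegral_matrixCoeff]
  exact ENNReal.mul_lt_top (by simp) (by simp)

/-- The matrix coefficient `z ↦ ⟪π(z) φ, ψ⟫` as an element of `L²(ℝ²ⁿ)`. -/
noncomputable def matrixCoeffL2 (φ ψ : L2Rn n) : L2R2n n := (memLp_matrixCoeff φ ψ).toLp _

theorem coeFn_matrixCoeffL2 (φ ψ : L2Rn n) : matrixCoeffL2 φ ψ =ᵐ[volume] matrixCoeff φ ψ :=
  MemLp.coeFn_toLp _

theorem norm_matrixCoeffL2 (φ ψ : L2Rn n) : ‖matrixCoeffL2 φ ψ‖ = ‖φ‖ * ‖ψ‖ := by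
  have h : ‖matrixCoeffL2 φ ψ‖ₑ ^ 2 = (‖φ‖ₑ * ‖ψ‖ₑ) ^ 2 := by
    rw [← lintegral_enorm_sq_coeFn, mul_pow, ← lintegral_matrixCoeff]
    refine lintegral_congr_ae ?_
    filter_upwards [coeFn_matrixCoeffL2 φ ψ] with z hz
    rw [hz]
  have h' := congrArg ENNReal.toReal h
  simp only [ENNReal.toReal_pow, ENNReal.toReal_mul, toReal_enorm] at h'
  exact (sq_eq_sq₀ (norm_nonneg _) (by positivity)).1 h'

theorem integral_shift_mul {u v : Rn n → ℂ} (hu : Integrable u) (hv : Integrable v) :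
    ∫ y, ∫ ξ, u (ξ + y) * v ξ = (∫ η, u η) * ∫ ξ, v ξ := by
  have h0 : Integrable (fun p : Rn n × Rn n => u (p.1 + p.2) * v p.1) (volume.prod volume) := by
    -- The shear `(ξ, y) ↦ (ξ, ξ + y)` preserves the product measure.
    have := (measurePreserving_prod_add (volume : Measure (Rn n)) volume).integrable_comp_of_integrable
      (hv.mul_prod hu)
    refine this.congr (Filter.Eventually.of_forall fun p => ?_)
    simp [mul_comm]
  rw [← integral_integral_swap h0]
  have h : ∀ ξ, ∫ y, u (ξ + y) * v ξ = (∫ η, u η) * v ξ := fun ξ => by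
    rw [integral_mul_const, integral_add_left_eq_self]
  simp_rw [h]
  rw [integral_const_mul]

/-- The orthogonality relations for the matrix coefficients of the Schrödinger representation. -/
theorem inner_matrixCoeffL2 (φ ψ φ' ψ' : L2Rn n) :
    inner ℂ (matrixCoeffL2 φ ψ) (matrixCoeffL2 φ' ψ') = inner ℂ φ' φ * inner ℂ ψ ψ' := by
  have h1 : inner ℂ (matrixCoeffL2 φ ψ) (matrixCoeffL2 φ' ψ')
      = ∫ z, inner ℂ (matrixCoeff φ ψ z) (matrixCoeff φ' ψ' z) := by
    rw [L2.inner_def]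
    refine integral_congr_ae ?_
    filter_upwards [coeFn_matrixCoeffL2 φ ψ, coeFn_matrixCoeffL2 φ' ψ'] with z h1 h2
    rw [h1, h2]
  have h2 : Integrable fun z => inner ℂ (matrixCoeff φ ψ z) (matrixCoeff φ' ψ' z) :=
    (L2.integrable_inner (𝕜 := ℂ) (matrixCoeffL2 φ ψ) (matrixCoeffL2 φ' ψ')).congr (by
      filter_upwards [coeFn_matrixCoeffL2 φ ψ, coeFn_matrixCoeffL2 φ' ψ'] with z h1 h2
      rw [h1, h2])
  rw [h1, Measure.volume_eq_prod, integral_prod_symm _ h2, L2.inner_def, L2.inner_def,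
    ← integral_shift_mul (L2.integrable_inner φ' φ) (L2.integrable_inner ψ ψ')]
  refine integral_congr_ae ?_
  filter_upwards [ae_memLp_shiftProd φ ψ, ae_memLp_shiftProd φ' ψ'] with y hy hy'
  calc ∫ x, inner ℂ (matrixCoeff φ ψ (x, y)) (matrixCoeff φ' ψ' (x, y))
      = ∫ x, inner ℂ (𝓕 (shiftProd φ ψ y) x) (𝓕 (shiftProd φ' ψ' y) x) := by
        refine integral_congr_ae (Filter.Eventually.of_forall fun x => ?_)
        simp only [matrixCoeff_eq, RCLike.inner_apply, map_mul]
        -- Both coefficients carry the same unimodular phase, which cancels.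
        rw [mul_mul_mul_comm, Complex.mul_conj', norm_phase]
        simp
    _ = ∫ ξ, inner ℂ (shiftProd φ ψ y ξ) (shiftProd φ' ψ' y ξ) :=
        integral_inner_fourier (integrable_shiftProd φ ψ y) hy (integrable_shiftProd φ' ψ' y) hy'
    _ = _ := by
        refine integral_congr_ae (Filter.Eventually.of_forall fun ξ => ?_)
        simp only [shiftProd, RCLike.inner_apply, map_mul, Complex.conj_conj]
        ring

end MatrixCoefficients

/-! ### The Weyl transform is an isometric isomorphism -/

section Weyl

variable {n : ℕ}

/-- The canonical commutation relation: both orders translate by `y + y'`, and their phases differ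
by the symplectic form. -/
theorem schrodinger_comm (x y x' y' : Rn n) (φ : L2Rn n) :
    schrodinger 1 x y 0 (schrodinger 1 x' y' 0 φ)
      = Complex.exp (2 * Real.pi * Complex.I * ((inner ℝ x' y - inner ℝ x y' : ℝ) : ℂ)) •
        schrodinger 1 x' y' 0 (schrodinger 1 x y 0 φ) := by
  apply Lp.ext
  have h1 := (coeFn_schrodinger 1 x y 0 (schrodinger 1 x' y' 0 φ)).trans
    (schrodingerFun_congr 1 x y 0 (coeFn_schrodinger 1 x' y' 0 φ))
  have h2 := (coeFn_schrodinger 1 x' y' 0 (schrodinger 1 x y 0 φ)).trans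
    (schrodingerFun_congr 1 x' y' 0 (coeFn_schrodinger 1 x y 0 φ))
  refine h1.trans (Filter.EventuallyEq.trans ?_ (Lp.coeFn_smul _ _).symm)
  filter_upwards [h2] with ξ h2
  rw [Pi.smul_apply, h2]
  simp only [schrodingerFun, schrodingerPhase, smul_eq_mul, add_right_comm ξ y' y]
  simp only [← mul_assoc, ← Complex.exp_add]
  congr 2
  simp only [inner_add_right]
  push_cast
  ring

/-- Moving both vectors by `π(w)` multiplies the coefficient by a character of `z`, and every
character of `ℝ²ⁿ` arises from some `w`. -/
theorem matrixCoeff_schrodinger (φ ψ : L2Rn n) (z w : Rn n × Rn n) :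
    matrixCoeff (schrodinger 1 w.1 w.2 0 φ) (schrodinger 1 w.1 w.2 0 ψ) z
      = Complex.exp (-(2 * Real.pi * Complex.I *
        ((inner ℝ w.1 z.2 - inner ℝ z.1 w.2 : ℝ) : ℂ))) * matrixCoeff φ ψ z := by
  rw [matrixCoeff, schrodinger_comm, inner_smul_left, LinearIsometry.inner_map_map, ← matrixCoeff,
    ← Complex.exp_conj]
  congr 2
  simp only [map_mul, Complex.conj_I, Complex.conj_ofReal, map_ofNat]
  ring

/-- Orthogonality to the coefficients of `π(w)φ` and `π(w)ψ` for all `w` says that the integrable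
function in the conclusion has Fourier transform zero. -/
theorem ae_inner_eq_zero_of_forall_inner_matrixCoeffL2 {g : L2R2n n}
    (h : ∀ φ ψ : L2Rn n, inner ℂ (matrixCoeffL2 φ ψ) g = 0) (φ ψ : L2Rn n) :
    ∀ᵐ z, inner ℂ (matrixCoeff φ ψ z) (g z) = 0 := by
  have hF : Integrable fun z => inner ℂ (matrixCoeff φ ψ z) (g z) :=
    (L2.integrable_inner (𝕜 := ℂ) (matrixCoeffL2 φ ψ) g).congr (by
      filter_upwards [coeFn_matrixCoeffL2 φ ψ] with z hz
      rw [hz])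
  -- The Fourier transform needs an inner product space, whereas the plain product carries the sup
  -- norm; hence the passage to the `L²` product.
  have hmp := WithLp.volume_preserving_ofLp (Rn n) (Rn n)
  have hme : MeasurableEmbedding (WithLp.ofLp (p := 2) (V := Rn n × Rn n)) :=
    (MeasurableEquiv.toLp 2 (Rn n × Rn n)).symm.measurableEmbedding
  have key := ae_eq_zero_of_fourier_eq_zero (hmp.integrable_comp_of_integrable hF) (fun w => by
    -- With `(-w.snd, w.fst)` the symplectic phase becomes the Fourier kernel `exp(-2πi⟪v, w⟫)`.
    have h1 := h (schrodinger 1 (-w.snd) w.fst 0 φ) (schrodinger 1 (-w.snd) w.fst 0 ψ)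
    rw [L2.inner_def] at h1
    rw [Real.fourier_eq', ← h1, ← hmp.integral_comp hme]
    refine integral_congr_ae ?_
    have h2 := hmp.quasiMeasurePreserving.ae (coeFn_matrixCoeffL2
      (schrodinger 1 (-w.snd) w.fst 0 φ) (schrodinger 1 (-w.snd) w.fst 0 ψ))
    filter_upwards [h2] with v hv
    have h3 := matrixCoeff_schrodinger φ ψ (WithLp.ofLp v) (-w.snd, w.fst)
    simp only at h3
    rw [hv, h3, Function.comp_apply, RCLike.inner_apply, RCLike.inner_apply, map_mul,
      ← Complex.exp_conj, smul_eq_mul, mul_left_comm (g v.ofLp)]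
    congr 2
    simp only [map_mul, Complex.conj_I, Complex.conj_ofReal, map_ofNat, map_neg,
      WithLp.prod_inner_apply, inner_neg_left, WithLp.fst, WithLp.snd,
      real_inner_comm v.ofLp.2 w.ofLp.2]
    push_cast
    ring)
  have := (hme.ae_map_iff (p := fun z => inner ℂ (matrixCoeff φ ψ z) (g z) = 0)).2 key
  rwa [hmp.map_eq] at this

/-- The matrix coefficients of the Schrödinger representation span a dense subspace. -/
theorem eq_zero_of_forall_inner_matrixCoeffL2 {g : L2R2n n}
    (h : ∀ φ ψ : L2Rn n, inner ℂ (matrixCoeffL2 φ ψ) g = 0) : g = 0 := by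
  obtain ⟨φ, hφ⟩ : ∃ φ : L2Rn n, φ ≠ 0 := by
    let s : Set (Rn n) := Metric.closedBall 0 1
    have hs : volume s ≠ ∞ := (measure_closedBall_lt_top).ne
    refine ⟨indicatorConstLp 2 (measurableSet_closedBall (x := (0 : Rn n)) (ε := 1)) hs 1, ?_⟩
    rw [← norm_ne_zero_iff, norm_indicatorConstLp (by norm_num) (by norm_num)]
    have : 0 < (volume : Measure (Rn n)).real s :=
      ENNReal.toReal_pos (Metric.measure_closedBall_pos _ _ one_pos).ne' hs
    simp only [norm_one, one_mul]
    exact (Real.rpow_pos_of_pos this _).ne'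
  have : Fact ((2 : ℝ≥0∞) ≠ ∞) := ⟨by norm_num⟩
  -- A countable dense set of vectors `ψ` leaves a single null set to discard.
  have h1 := ae_all_iff.2 fun k : ℕ =>
    ae_inner_eq_zero_of_forall_inner_matrixCoeffL2 h φ (TopologicalSpace.denseSeq (L2Rn n) k)
  rw [Lp.eq_zero_iff_ae_eq_zero]
  filter_upwards [h1] with z hz
  -- Where `g z ≠ 0`, the vector `π(z)φ` is orthogonal to a dense set and so vanishes, although
  -- `π(z)` is isometric and `φ ≠ 0`.
  by_contra hg
  have hg' : g z ≠ 0 := hg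
  have h2 : ∀ k, matrixCoeff φ (TopologicalSpace.denseSeq (L2Rn n) k) z = 0 := fun k => by
    have := hz k
    rw [RCLike.inner_apply, mul_eq_zero] at this
    simpa [hg'] using this
  have h3 : ∀ ψ : L2Rn n, inner ℂ (schrodinger 1 z.1 z.2 0 φ) ψ = 0 := fun ψ =>
    (TopologicalSpace.denseRange_denseSeq (L2Rn n)).induction_on
      (p := fun ψ => inner ℂ (schrodinger 1 z.1 z.2 0 φ) ψ = 0) ψ
      (isClosed_eq (by fun_prop) continuous_const) h2
  have h4 := h3 (schrodinger 1 z.1 z.2 0 φ)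
  rw [inner_self_eq_zero] at h4
  exact hφ ((schrodinger 1 z.1 z.2 0).injective (h4.trans (map_zero _).symm))

/-- `ψ ↦ (z ↦ ⟪π(z) φ, ψ⟫)` as a continuous linear map. -/
noncomputable def matrixCoeffCLM (φ : L2Rn n) : L2Rn n →L[ℂ] L2R2n n :=
  LinearMap.mkContinuous
    { toFun := matrixCoeffL2 φ
      map_add' := fun ψ ψ' => by
        apply Lp.ext
        filter_upwards [coeFn_matrixCoeffL2 φ (ψ + ψ'), coeFn_matrixCoeffL2 φ ψ,
          coeFn_matrixCoeffL2 φ ψ', Lp.coeFn_add (matrixCoeffL2 φ ψ) (matrixCoeffL2 φ ψ')]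
          with z h1 h2 h3 h4
        rw [h1, h4, Pi.add_apply, h2, h3, matrixCoeff, inner_add_right, matrixCoeff, matrixCoeff]
      map_smul' := fun c ψ => by
        apply Lp.ext
        filter_upwards [coeFn_matrixCoeffL2 φ (c • ψ), coeFn_matrixCoeffL2 φ ψ,
          Lp.coeFn_smul c (matrixCoeffL2 φ ψ)] with z h1 h2 h3
        rw [h1, RingHom.id_apply, h3, Pi.smul_apply, h2, matrixCoeff, inner_smul_right, matrixCoeff,
          smul_eq_mul] } ‖φ‖ fun ψ => (norm_matrixCoeffL2 φ ψ).le

/-- `φ ↦ (z ↦ ⟪π(z) φ, ψ⟫)` as a continuous conjugate linear map. -/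
noncomputable def matrixCoeffConjCLM (ψ : L2Rn n) : L2Rn n →L⋆[ℂ] L2R2n n :=
  LinearMap.mkContinuous
    { toFun := fun φ => matrixCoeffL2 φ ψ
      map_add' := fun φ φ' => by
        apply Lp.ext
        filter_upwards [coeFn_matrixCoeffL2 (φ + φ') ψ, coeFn_matrixCoeffL2 φ ψ,
          coeFn_matrixCoeffL2 φ' ψ, Lp.coeFn_add (matrixCoeffL2 φ ψ) (matrixCoeffL2 φ' ψ)]
          with z h1 h2 h3 h4
        rw [h1, h4, Pi.add_apply, h2, h3, matrixCoeff, map_add, inner_add_left, matrixCoeff,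
          matrixCoeff]
      map_smul' := fun c φ => by
        apply Lp.ext
        filter_upwards [coeFn_matrixCoeffL2 (c • φ) ψ, coeFn_matrixCoeffL2 φ ψ,
          Lp.coeFn_smul ((starRingEnd ℂ) c) (matrixCoeffL2 φ ψ)] with z h1 h2 h3
        rw [h1, h3, Pi.smul_apply, h2, matrixCoeff, map_smul, inner_smul_left, matrixCoeff,
          smul_eq_mul] } ‖ψ‖ fun φ => by
            rw [mul_comm]
            exact (norm_matrixCoeffL2 φ ψ).le

/-- The weak integral is an `L²` inner product with a matrix coefficient, so the entries of `T` in
an orthonormal basis are coordinates of `g`. -/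
theorem isWeylTransform_iff (g : L2R2n n) (T : HS (L2Rn n)) :
    IsWeylTransform g T ↔
      ∀ φ ψ : L2Rn n, inner ℂ ψ (HS.toCLM T φ) = inner ℂ (matrixCoeffL2 φ ψ) g := by
  refine forall_congr' fun φ => forall_congr' fun ψ => ?_
  have : inner ℂ (matrixCoeffL2 φ ψ) g
      = ∫ z : Rn n × Rn n, g z * inner ℂ ψ (schrodinger 1 z.1 z.2 0 φ) := by
    rw [L2.inner_def]
    refine integral_congr_ae ?_
    filter_upwards [coeFn_matrixCoeffL2 φ ψ] with z hz
    rw [hz, RCLike.inner_apply, matrixCoeff, inner_conj_symm]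
  rw [this]

/-- Both sides are continuous, linear in `φ` and conjugate linear in `ψ`; the basis is replaced by
arbitrary vectors in one variable after the other. -/
theorem inner_eq_inner_matrixCoeffL2_of_basis {ι : Type*} (e : HilbertBasis ι ℂ (L2Rn n))
    (T : L2Rn n →L[ℂ] L2Rn n) (g : L2R2n n)
    (h : ∀ i j, inner ℂ (e j) (T (e i)) = inner ℂ (matrixCoeffL2 (e i) (e j)) g)
    (φ ψ : L2Rn n) : inner ℂ ψ (T φ) = inner ℂ (matrixCoeffL2 φ ψ) g := by
  have hd : Dense (Submodule.span ℂ (Set.range e) : Set (L2Rn n)) :=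
    Submodule.dense_iff_topologicalClosure_eq_top.2 e.dense_span
  have h1 : ∀ j φ, inner ℂ (e j) (T φ) = inner ℂ (matrixCoeffL2 φ (e j)) g := by
    intro j φ
    have : (innerSL ℂ (e j)).comp T
        = (innerSLFlip ℂ g).comp (matrixCoeffConjCLM (e j)) :=
      ContinuousLinearMap.ext_on hd (by rintro _ ⟨i, rfl⟩; exact h i j)
    exact congrArg (fun A => A φ) this
  have h2 : innerSL ℂ (T φ) = (innerSL ℂ g).comp (matrixCoeffCLM φ) :=
    ContinuousLinearMap.ext_on hd (by
      rintro _ ⟨j, rfl⟩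
      have := congrArg (starRingEnd ℂ) (h1 j φ)
      rwa [inner_conj_symm, inner_conj_symm] at this)
  have h3 := congrArg (starRingEnd ℂ) (congrArg (fun A => A ψ) h2)
  simp only [innerSL_apply_apply, ContinuousLinearMap.comp_apply, inner_conj_symm] at h3
  exact h3

/-- The matrix coefficients of an orthonormal basis of `L²(ℝⁿ)`, an orthonormal basis of
`L²(ℝ²ⁿ)`. -/
noncomputable def matrixCoeffBasis {ι : Type*} (e : HilbertBasis ι ℂ (L2Rn n)) :
    HilbertBasis (ι × ι) ℂ (L2R2n n) :=
  HilbertBasis.mkOfOrthogonalEqBot (v := fun p : ι × ι => matrixCoeffL2 (e p.1) (e p.2))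
    (by
      classical
      rw [orthonormal_iff_ite]
      rintro ⟨i, j⟩ ⟨i', j'⟩
      rw [inner_matrixCoeffL2, orthonormal_iff_ite.1 e.orthonormal, orthonormal_iff_ite.1 e.orthonormal]
      simp only [Prod.mk.injEq]
      split_ifs <;> simp_all)
    (by
      rw [Submodule.eq_bot_iff]
      intro g hg
      rw [Submodule.mem_orthogonal] at hg
      refine eq_zero_of_forall_inner_matrixCoeffL2 fun φ ψ => ?_
      -- The operator `0` extends orthogonality from the basis coefficients to all `φ`, `ψ`.
      rw [← inner_eq_inner_matrixCoeffL2_of_basis e 0 g]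
      · simp
      · intro i j
        rw [hg _ (Submodule.subset_span ⟨(i, j), rfl⟩)]
        simp)

theorem matrixCoeffBasis_apply {ι : Type*} (e : HilbertBasis ι ℂ (L2Rn n)) (p : ι × ι) :
    matrixCoeffBasis e p = matrixCoeffL2 (e p.1) (e p.2) := by
  rw [matrixCoeffBasis, HilbertBasis.coe_mkOfOrthogonalEqBot]

theorem hasSum_norm_inner_sq {ι H : Type*} [NormedAddCommGroup H] [InnerProductSpace ℂ H]
    (e : HilbertBasis ι ℂ H) (x : H) :
    HasSum (fun j => ‖(inner ℂ (e j) x : ℂ)‖ ^ 2) (‖x‖ ^ 2) := by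
  have h1 := e.hasSum_inner_mul_inner x x
  rw [← Complex.hasSum_ofReal]
  rw [inner_self_eq_norm_sq_to_K] at h1
  simp_rw [← inner_conj_symm x (e _), Complex.conj_mul'] at h1
  simpa using h1

/-- The Hilbert--Schmidt condition says that the matrix entries of `T` are square summable; `g` is
the function with these coordinates in `matrixCoeffBasis`. -/
theorem exists_isWeylTransform (T : HS (L2Rn n)) : ∃ g, IsWeylTransform g T := by
  obtain ⟨t, ht⟩ : ∃ t : onbIndex (L2Rn n) × onbIndex (L2Rn n) → ℂ,
      ∀ i j, t (i, j) = inner ℂ (onb (L2Rn n) j) (HS.toCLM T (onb (L2Rn n) i)) :=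
    ⟨fun p => inner ℂ (onb (L2Rn n) p.2) (HS.toCLM T (onb (L2Rn n) p.1)), fun _ _ => rfl⟩
  have hs : Summable fun p => ‖t p‖ ^ 2 := by
    rw [summable_prod_of_nonneg fun p => by positivity]
    simp_rw [ht]
    exact ⟨fun i => (hasSum_norm_inner_sq _ _).summable,
      (HS.summable_sq T).congr fun i => (hasSum_norm_inner_sq _ _).tsum_eq.symm⟩
  have hmem : Memℓp t 2 := memℓp_gen (by simpa using hs)
  refine ⟨(matrixCoeffBasis (onb (L2Rn n))).repr.symm ⟨t, hmem⟩, (isWeylTransform_iff _ T).2 ?_⟩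
  refine inner_eq_inner_matrixCoeffL2_of_basis (onb (L2Rn n)) _ _ fun i j => ?_
  rw [← matrixCoeffBasis_apply (onb (L2Rn n)) (i, j), ← ht,
    ← HilbertBasis.repr_apply_apply (matrixCoeffBasis _), LinearIsometryEquiv.apply_symm_apply]

theorem isWeylTransform_weylInverse (T : HS (L2Rn n)) : IsWeylTransform (weylInverse T) T :=
  Classical.epsilon_spec (exists_isWeylTransform T)

/-- Parseval on both sides: the matrix entries of the operators are the coordinates of their
symbols. -/
theorem inner_weylInverse (S T : HS (L2Rn n)) :
    inner ℂ (weylInverse S) (weylInverse T) = inner ℂ S T := by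
  let e := onb (L2Rn n)
  have hS := (isWeylTransform_iff _ S).1 (isWeylTransform_weylInverse S)
  have hT := (isWeylTransform_iff _ T).1 (isWeylTransform_weylInverse T)
  have h1 := (matrixCoeffBasis e).hasSum_inner_mul_inner (weylInverse S) (weylInverse T)
  have h2 : ∀ i, HasSum (fun j => inner ℂ (weylInverse S) (matrixCoeffBasis e (i, j)) *
      inner ℂ (matrixCoeffBasis e (i, j)) (weylInverse T))
      (inner ℂ (HS.toCLM S (e i)) (HS.toCLM T (e i))) := by
    intro i
    have := e.hasSum_inner_mul_inner (HS.toCLM S (e i)) (HS.toCLM T (e i))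
    simp_rw [matrixCoeffBasis_apply, ← hT, ← inner_conj_symm (weylInverse S), ← hS,
      inner_conj_symm]
    exact this
  rw [HS.inner_eq, ← (h1.prod_fiberwise h2).tsum_eq]

theorem norm_weylInverse (T : HS (L2Rn n)) : ‖weylInverse T‖ = ‖T‖ := by
  rw [@norm_eq_sqrt_re_inner ℂ, @norm_eq_sqrt_re_inner ℂ, inner_weylInverse]

end Weyl

/-! ### The Fourier transform on `L²(ℝ^*; dκ)` -/

section GroupFourier

section General

variable {E : Type*} [NormedAddCommGroup E] [InnerProductSpace ℂ E]

/-! ### Logarithmic coordinates on the two half lines. -/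

theorem coeFn_logPullback (ε : ℤˣ) (F : Lp E 2 haarMul) :
    logPullback ε F =ᵐ[volume] fun u => F (halfExp ε u) :=
  MemLp.coeFn_toLp (((Lp.memLp F).restrict (Set.range (halfExp ε))).comp_measurePreserving
    (measurePreserving_halfExp ε))

theorem quasiMeasurePreserving_halfExp (ε : ℤˣ) :
    Measure.QuasiMeasurePreserving (halfExp ε) volume haarMul :=
  (measurePreserving_halfExp ε).quasiMeasurePreserving.mono_right
    Measure.absolutelyContinuous_restrict

theorem logPullback_add (ε : ℤˣ) (F F' : Lp E 2 haarMul) :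
    logPullback ε (F + F') = logPullback ε F + logPullback ε F' := by
  apply Lp.ext
  filter_upwards [coeFn_logPullback ε (F + F'), coeFn_logPullback ε F, coeFn_logPullback ε F',
    Lp.coeFn_add (logPullback ε F) (logPullback ε F'),
    (quasiMeasurePreserving_halfExp ε).ae_eq (Lp.coeFn_add F F')] with u h1 h2 h3 h4 h5
  rw [h1, h4, Pi.add_apply, h2, h3]
  exact h5

theorem logPullback_smul (ε : ℤˣ) (c : ℂ) (F : Lp E 2 haarMul) :
    logPullback ε (c • F) = c • logPullback ε F := by
  apply Lp.ext
  filter_upwards [coeFn_logPullback ε (c • F), coeFn_logPullback ε F,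
    Lp.coeFn_smul c (logPullback ε F),
    (quasiMeasurePreserving_halfExp ε).ae_eq (Lp.coeFn_smul c F)] with u h1 h2 h3 h4
  rw [h1, h3, Pi.smul_apply, h2]
  exact h4

theorem range_halfExp_one : Set.range (halfExp 1) = Set.Ioi 0 := by
  have : halfExp 1 = Real.exp := by ext; simp [halfExp]
  rw [this, Real.range_exp]

theorem range_halfExp_neg_one : Set.range (halfExp (-1)) = Set.Iio 0 := by
  ext x
  constructor
  · rintro ⟨u, rfl⟩
    simp [halfExp, Real.exp_pos]
  · intro hx
    refine ⟨Real.log (-x), ?_⟩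
    rw [halfExp, Real.exp_log (neg_pos.2 hx)]
    simp

theorem haarMul_singleton_zero : haarMul {0} = 0 := by
  rw [haarMul, withDensity_apply _ (measurableSet_singleton 0)]
  simp

/-- Each half line with `κ` is a copy of `ℝ` with Lebesgue measure, and `{0}` is `κ`-null. -/
theorem inner_eq_sum_logPullback (F F' : Lp E 2 haarMul) :
    inner ℂ F F' = inner ℂ (logPullback 1 F) (logPullback 1 F')
      + inner ℂ (logPullback (-1) F) (logPullback (-1) F') := by
  have h : ∀ ε, inner ℂ (logPullback ε F) (logPullback ε F')
      = ∫ x in Set.range (halfExp ε), inner ℂ (F x) (F' x) ∂haarMul := by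
    intro ε
    rw [← (measurePreserving_halfExp ε).integral_comp (measurableEmbedding_halfExp ε), L2.inner_def]
    refine integral_congr_ae ?_
    filter_upwards [coeFn_logPullback ε F, coeFn_logPullback ε F'] with u h1 h2
    rw [h1, h2]
  have hI : Integrable (fun x => (inner ℂ (F x) (F' x) : ℂ)) haarMul := L2.integrable_inner F F'
  have hsplit := integral_add_compl (measurableSet_Ioi (a := (0 : ℝ))) hI
  rw [Set.compl_Ioi, setIntegral_congr_set (Iio_ae_eq_Iic' haarMul_singleton_zero).symm] at hsplit
  rw [h, h, range_halfExp_one, range_halfExp_neg_one, hsplit, L2.inner_def]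

/-! #### Translations and phase factors -/

theorem memLp_phase_smul (t : ℝ) (f : Lp E 2 (volume : Measure ℝ)) :
    MemLp (fun v => Complex.exp (-(2 * Real.pi * Complex.I * ((t * v : ℝ) : ℂ))) • f v) 2 :=
  memLp_isometric
    (fun p : ℝ × E => Complex.exp (-(2 * Real.pi * Complex.I * ((t * p.1 : ℝ) : ℂ))) • p.2)
    (by fun_prop) (fun r v => by rw [norm_smul, norm_phase, one_mul]) (Lp.memLp f)

/-- Multiplication by `v ↦ exp (-2πi t v)` on `L²(ℝ)`. -/
noncomputable def phaseMul (t : ℝ) (f : Lp E 2 (volume : Measure ℝ)) :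
    Lp E 2 (volume : Measure ℝ) := (memLp_phase_smul t f).toLp _

theorem coeFn_phaseMul (t : ℝ) (f : Lp E 2 (volume : Measure ℝ)) : phaseMul t f =ᵐ[volume]
    fun v => Complex.exp (-(2 * Real.pi * Complex.I * ((t * v : ℝ) : ℂ))) • f v :=
  MemLp.coeFn_toLp _

theorem isometry_phaseMul (t : ℝ) :
    Isometry (phaseMul t : Lp E 2 (volume : Measure ℝ) → Lp E 2 (volume : Measure ℝ)) := by
  refine Isometry.of_dist_eq fun f g => ?_
  rw [Lp.dist_def, Lp.dist_def]
  congr 1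
  refine eLpNorm_congr_norm_ae ?_
  filter_upwards [coeFn_phaseMul t f, coeFn_phaseMul t g] with v h1 h2
  rw [Pi.sub_apply, Pi.sub_apply, h1, h2, ← smul_sub, norm_smul, norm_phase, one_mul]

variable [CompleteSpace E]

/-- Both sides are continuous in `f`, and on the dense set of Schwartz functions the identity is a
substitution in the Fourier integral. -/
theorem fourier_translate (t : ℝ) (f : Lp E 2 (volume : Measure ℝ)) :
    𝓕 (Lp.compMeasurePreserving (fun u => u - t) (measurePreserving_sub_right volume t) f)
      = phaseMul t (𝓕 f : Lp E 2 (volume : Measure ℝ)) := by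
  refine (SchwartzMap.denseRange_toLpCLM (F := E) (μ := (volume : Measure ℝ)) (p := 2)
    ENNReal.ofNat_ne_top).induction_on (p := fun f => 𝓕 (Lp.compMeasurePreserving (fun u => u - t)
      (measurePreserving_sub_right volume t) f) = phaseMul t (𝓕 f : Lp E 2 (volume : Measure ℝ)))
    f ?_ ?_
  · refine isClosed_eq ?_ ?_
    · exact (Lp.fourierTransformₗᵢ ℝ E).continuous.comp
        (Lp.compMeasurePreservingₗᵢ ℂ (fun u : ℝ => u - t)
          (measurePreserving_sub_right volume t)).continuous
    · exact (isometry_phaseMul t).continuous.comp (Lp.fourierTransformₗᵢ ℝ E).continuous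
  · intro S
    have hS : Integrable S := S.integrable
    have h0 := S.coeFn_toLp 2 (volume : Measure ℝ)
    have hco : Lp.compMeasurePreserving (fun u => u - t) (measurePreserving_sub_right volume t)
        (S.toLp 2 volume) =ᵐ[volume] fun u => S (u + -t) := by
      refine (Lp.coeFn_compMeasurePreserving _ _).trans ?_
      exact (measurePreserving_sub_right volume t).quasiMeasurePreserving.ae_eq h0
    have hint : Integrable fun u => S (u + -t) := hS.comp_add_right _
    apply Lp.ext
    refine (coeFn_fourier_ae_eq _ ((integrable_congr hco).2 hint)).trans ?_
    have h1 := coeFn_phaseMul t (𝓕 (S.toLp 2 volume) : Lp E 2 (volume : Measure ℝ))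
    have h2 := coeFn_fourier_ae_eq (S.toLp 2 (volume : Measure ℝ)) ((integrable_congr h0).2 hS)
    simp only [SchwartzMap.toLpCLM_apply]
    filter_upwards [h1, h2] with v h1 h2
    rw [h1, h2, Real.fourier_real_eq_integral_exp_smul, Real.fourier_real_eq_integral_exp_smul,
      ← integral_smul, ← integral_add_right_eq_self _ t]
    have hco' : ∀ᵐ u, (Lp.compMeasurePreserving (fun u => u - t)
        (measurePreserving_sub_right volume t) (S.toLp 2 volume)) (u + t) = S (u + t + -t) :=
      (measurePreserving_add_right volume t).quasiMeasurePreserving.ae hco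
    refine integral_congr_ae ?_
    filter_upwards [h0, hco'] with u h0 h3
    rw [h0, h3, smul_smul, ← Complex.exp_add, add_neg_cancel_right]
    congr 2
    push_cast
    ring

/-! ### The Fourier transform of `ℝ^*` on `L²`, Plancherel and dilations. -/

/-- `v ↦ F̂(e^v, j)` as an element of `L²(ℝ)`. -/
noncomputable def groupFourierL2 (j : ℤˣ) : Lp E 2 haarMul →ₗ[ℂ] Lp E 2 (volume : Measure ℝ) where
  toFun F := 𝓕 (logPullback 1 F) + ((j : ℤ) : ℂ) • 𝓕 (logPullback (-1) F)
  map_add' F F' := by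
    simp only [logPullback_add, FourierTransform.fourier_add, smul_add]
    abel
  map_smul' c F := by
    simp only [logPullback_smul, FourierTransform.fourier_smul, smul_add, RingHom.id_apply]
    rw [smul_comm c]

theorem coeFn_groupFourierL2 (j : ℤˣ) (F : Lp E 2 haarMul) :
    groupFourierL2 j F =ᵐ[volume] fun v => groupFourier F (Real.exp v) j := by
  have h : groupFourierL2 j F = 𝓕 (logPullback 1 F) + ((j : ℤ) : ℂ) • 𝓕 (logPullback (-1) F) := rfl
  rw [h]
  filter_upwards [Lp.coeFn_add (𝓕 (logPullback 1 F)) (((j : ℤ) : ℂ) • 𝓕 (logPullback (-1) F)),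
    Lp.coeFn_smul ((j : ℤ) : ℂ) (𝓕 (logPullback (-1) F))] with v h1 h2
  rw [h1, Pi.add_apply, h2, groupFourier, Real.log_exp, Pi.smul_apply]

/-- Plancherel's theorem for the group `ℝ^*`. -/
theorem inner_eq_half_sum_groupFourierL2 (F F' : Lp E 2 haarMul) :
    inner ℂ F F' = 1 / 2 * ∑ j : ℤˣ, inner ℂ (groupFourierL2 j F) (groupFourierL2 j F') := by
  have h : ∀ j (F : Lp E 2 haarMul), groupFourierL2 j F
      = 𝓕 (logPullback 1 F) + ((j : ℤ) : ℂ) • 𝓕 (logPullback (-1) F) := fun _ _ => rfl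
  rw [UnitsInt.univ, Finset.sum_pair (by decide), h, h, h, h, inner_eq_sum_logPullback,
    ← Lp.inner_fourier_eq (logPullback 1 F), ← Lp.inner_fourier_eq (logPullback (-1) F)]
  -- In `⟪P + jQ, P' + jQ'⟫` the cross terms carry the sign `j` and cancel over `j = ±1`, while the
  -- other two terms are counted twice.
  simp only [inner_add_left, inner_add_right, inner_smul_left, inner_smul_right]
  simp
  ring

/-- A dilation by `e^t` is the translation by `t` on both half lines, so one phase factors out for
either `j`. -/
theorem groupFourier_translate {F F' : Lp E 2 haarMul} (t : ℝ)
    (h : ∀ᵐ x ∂haarMul, F' x = F (x / Real.exp t)) (j : ℤˣ) :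
    ∀ᵐ v, groupFourier F' (Real.exp v) j
      = Complex.exp (-(2 * Real.pi * Complex.I * ((t * v : ℝ) : ℂ))) • groupFourier F (Real.exp v) j := by
  have h1 : ∀ ε, logPullback ε F' = Lp.compMeasurePreserving (fun u => u - t)
      (measurePreserving_sub_right volume t) (logPullback ε F) := by
    intro ε
    apply Lp.ext
    have hmp := measurePreserving_sub_right (volume : Measure ℝ) t
    filter_upwards [coeFn_logPullback ε F', Lp.coeFn_compMeasurePreserving (logPullback ε F) hmp,
      hmp.quasiMeasurePreserving.ae_eq (coeFn_logPullback ε F),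
      (quasiMeasurePreserving_halfExp ε).ae h] with u h1 h2 h3 h4
    rw [h1, h2, h3, h4, Function.comp_apply]
    congr 1
    rw [halfExp, halfExp, Real.exp_sub, mul_div_assoc]
  simp only [groupFourier, Real.log_exp, h1, fourier_translate]
  filter_upwards [coeFn_phaseMul t (𝓕 (logPullback 1 F)), coeFn_phaseMul t (𝓕 (logPullback (-1) F))]
    with v h2 h3
  rw [h2, h3, smul_add, smul_comm]

theorem stronglyMeasurable_groupFourier_exp (F : Lp E 2 haarMul) (j : ℤˣ) :
    StronglyMeasurable fun v => groupFourier F (Real.exp v) j := by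
  simp only [groupFourier, Real.log_exp]
  exact (Lp.stronglyMeasurable _).add ((Lp.stronglyMeasurable _).const_smul _)

theorem inner_groupFourierL2 (j : ℤˣ) (F F' : Lp E 2 haarMul) :
    inner ℂ (groupFourierL2 j F) (groupFourierL2 j F')
      = ∫ v, inner ℂ (groupFourier F (Real.exp v) j) (groupFourier F' (Real.exp v) j) := by
  rw [L2.inner_def]
  refine integral_congr_ae ?_
  filter_upwards [coeFn_groupFourierL2 j F, coeFn_groupFourierL2 j F'] with v h1 h2
  rw [h1, h2]

theorem integrable_inner_groupFourier (j : ℤˣ) (F F' : Lp E 2 haarMul) :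
    Integrable fun v => (inner ℂ (groupFourier F (Real.exp v) j) (groupFourier F' (Real.exp v) j) : ℂ) := by
  refine (L2.integrable_inner (𝕜 := ℂ) (groupFourierL2 j F) (groupFourierL2 j F')).congr ?_
  filter_upwards [coeFn_groupFourierL2 j F, coeFn_groupFourierL2 j F'] with v h1 h2
  rw [h1, h2]

theorem lintegral_groupFourier_sq (F : Lp E 2 haarMul) :
    ∑ j : ℤˣ, ∫⁻ v, ‖groupFourier F (Real.exp v) j‖ₑ ^ 2 = 2 * ‖F‖ₑ ^ 2 := by
  have h0 : ∀ j, ∫⁻ v, ‖groupFourier F (Real.exp v) j‖ₑ ^ 2 = ‖groupFourierL2 j F‖ₑ ^ 2 := by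
    intro j
    rw [← lintegral_enorm_sq_coeFn]
    refine lintegral_congr_ae ?_
    filter_upwards [coeFn_groupFourierL2 j F] with v h1
    rw [h1]
  have h1 := inner_eq_half_sum_groupFourierL2 F F
  simp only [inner_self_eq_norm_sq_to_K] at h1
  have h2 : ∑ j : ℤˣ, ‖groupFourierL2 j F‖ ^ 2 = 2 * ‖F‖ ^ 2 := by
    have h3 : ((‖F‖ ^ 2 : ℝ) : ℂ) = ((1 / 2 * ∑ j : ℤˣ, ‖groupFourierL2 j F‖ ^ 2 : ℝ) : ℂ) := by
      push_cast
      exact h1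
    have := Complex.ofReal_injective h3
    linarith
  simp_rw [h0, ← ofReal_norm, ← ENNReal.ofReal_pow (norm_nonneg _)]
  rw [← ENNReal.ofReal_sum_of_nonneg fun _ _ => by positivity, h2,
    ENNReal.ofReal_mul (by norm_num), ENNReal.ofReal_ofNat]

end General

/-! #### Periodization -/

/-- Lebesgue measure is the sum of the translates by `ℤ / b` of its restriction to `(0, 1/b)`. -/
theorem volume_eq_sum_map_add {b : ℝ} (hb : 0 < b) :
    (volume : Measure ℝ) = Measure.sum fun s : ℤ =>
      (volume.restrict (Set.Ioo 0 (1 / b))).map fun v => v + s / b := by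
  have hT : 0 < 1 / b := by positivity
  have h1 := Measure.restrict_iUnion (μ := (volume : Measure ℝ))
    (Set.pairwise_disjoint_Ioc_zsmul (1 / b)) fun s : ℤ => measurableSet_Ioc
  rw [iUnion_Ioc_zsmul hT, Measure.restrict_univ] at h1
  rw [h1]
  congr 1
  ext1 s
  have hmp := measurePreserving_add_right (volume : Measure ℝ) ((s : ℝ) / b)
  have h2 := (hmp.restrict_preimage
    (measurableSet_Ioc (a := s • (1 / b)) (b := (s + 1) • (1 / b)))).map_eq
  rw [← h1, ← h2]
  congr 1
  rw [Measure.restrict_congr_set Ioo_ae_eq_Ioc]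
  congr 1
  ext v
  simp only [Set.mem_preimage, Set.mem_Ioc, zsmul_eq_mul]
  push_cast
  constructor <;> rintro ⟨h3, h4⟩ <;> constructor <;> ring_nf at * <;> linarith

theorem ae_volume_iff {b : ℝ} (hb : 0 < b) {p : ℝ → Prop} :
    (∀ᵐ v, p v) ↔ ∀ s : ℤ, ∀ᵐ v ∂(volume.restrict (Set.Ioo 0 (1 / b))), p (v + s / b) := by
  conv_lhs => rw [volume_eq_sum_map_add hb, Measure.ae_sum_iff]
  refine forall_congr' fun s => ?_
  exact (measurableEmbedding_addRight ((s : ℝ) / b)).ae_map_iff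

theorem lintegral_eq_lintegral_tsum {b : ℝ} (hb : 0 < b) {f : ℝ → ℝ≥0∞} (hf : Measurable f) :
    ∫⁻ v, f v = ∫⁻ v in Set.Ioo 0 (1 / b), ∑' s : ℤ, f (v + s / b) := by
  rw [volume_eq_sum_map_add hb, lintegral_sum_measure, ← volume_eq_sum_map_add hb, lintegral_tsum]
  · exact tsum_congr fun s => lintegral_map hf (by fun_prop)
  · intro s
    fun_prop

theorem integral_eq_integral_tsum {b : ℝ} (hb : 0 < b) {f : ℝ → ℂ} (hf : Integrable f)
    (hfm : StronglyMeasurable f) :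
    ∫ v, f v = ∫ v in Set.Ioo 0 (1 / b), ∑' s : ℤ, f (v + s / b) := by
  have hfin : ∫⁻ v, ‖f v‖ₑ < ∞ := hf.2
  have hm : ∀ s : ℤ, StronglyMeasurable fun v => f (v + s / b) := fun s =>
    hfm.comp_measurable (by fun_prop)
  have h1 : ∫ v, f v = ∑' s : ℤ, ∫ v in Set.Ioo 0 (1 / b), f (v + s / b) := by
    have h := integral_sum_measure (μ := fun s : ℤ =>
      (volume.restrict (Set.Ioo 0 (1 / b))).map fun v => v + s / b) (f := f)
      (by rwa [← volume_eq_sum_map_add hb])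
    rw [← volume_eq_sum_map_add hb] at h
    rw [h]
    exact tsum_congr fun s => integral_map (by fun_prop) hfm.aestronglyMeasurable
  rw [h1, integral_tsum fun s => (hm s).aestronglyMeasurable]
  -- The absolute convergence required for the exchange is the integrability of `f` itself,
  -- periodized.
  rw [← lintegral_tsum fun s => (hm s).enorm.aemeasurable,
    ← lintegral_eq_lintegral_tsum hb hfm.enorm]
  exact hfin.ne

theorem ae_summable_enorm {b : ℝ} (hb : 0 < b) {f : ℝ → ℂ} (hf : Integrable f)
    (hfm : StronglyMeasurable f) :
    ∀ᵐ v ∂(volume.restrict (Set.Ioo 0 (1 / b))), Summable fun s : ℤ => f (v + s / b) := by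
  have hfin : ∫⁻ v, ‖f v‖ₑ < ∞ := hf.2
  rw [lintegral_eq_lintegral_tsum hb hfm.enorm] at hfin
  have hm : ∀ s : ℤ, Measurable fun v => ‖f (v + s / b)‖ₑ := fun s =>
    (hfm.comp_measurable (by fun_prop : Measurable fun v : ℝ => v + s / b)).enorm
  filter_upwards [ae_lt_top (Measurable.tsum hm) hfin.ne] with v hv
  refine Summable.of_norm ?_
  have := ENNReal.summable_toReal hv.ne
  simpa using this

/-- The substitution `ν = e^v` for statements that hold almost everywhere. -/
theorem ae_Ioo_log_iff {T : ℝ} {p : ℝ → Prop} :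
    (∀ᵐ ν ∂(volume.restrict (Set.Ioo 1 (Real.exp T))), p (Real.log ν)) ↔
      ∀ᵐ v ∂(volume.restrict (Set.Ioo 0 T)), p v := by
  rw [ae_restrict_iff' measurableSet_Ioo, ae_restrict_iff' measurableSet_Ioo, ae_iff, ae_iff]
  constructor
  · intro h
    have : {v | ¬ (v ∈ Set.Ioo 0 T → p v)}
        ⊆ Real.log '' {ν | ¬ (ν ∈ Set.Ioo 1 (Real.exp T) → p (Real.log ν))} := by
      intro v hv
      simp only [Set.mem_ofPred_eq, Classical.not_imp, Set.mem_Ioo] at hv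
      refine ⟨Real.exp v, ?_, Real.log_exp v⟩
      simp only [Set.mem_ofPred_eq, Classical.not_imp, Set.mem_Ioo, Real.log_exp, Real.one_lt_exp_iff,
        Real.exp_lt_exp]
      exact hv
    -- A differentiable map sends null sets to null sets; `log` serves in this direction and `exp`
    -- in the other.
    refine measure_mono_null this (addHaar_image_eq_zero_of_differentiableOn_of_addHaar_eq_zero
      (μ := volume) ?_ h)
    intro ν hν
    simp only [Set.mem_ofPred_eq, Classical.not_imp, Set.mem_Ioo] at hν
    exact (Real.differentiableAt_log (by linarith [hν.1.1])).differentiableWithinAt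
  · intro h
    have : {ν | ¬ (ν ∈ Set.Ioo 1 (Real.exp T) → p (Real.log ν))}
        ⊆ Real.exp '' {v | ¬ (v ∈ Set.Ioo 0 T → p v)} := by
      intro ν hν
      simp only [Set.mem_ofPred_eq, Classical.not_imp, Set.mem_Ioo] at hν
      have hpos : 0 < ν := by linarith [hν.1.1]
      refine ⟨Real.log ν, ?_, Real.exp_log hpos⟩
      simp only [Set.mem_ofPred_eq, Classical.not_imp, Set.mem_Ioo]
      exact ⟨⟨Real.log_pos hν.1.1, (Real.log_lt_iff_lt_exp hpos).2 hν.1.2⟩, hν.2⟩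
    exact measure_mono_null this (addHaar_image_eq_zero_of_differentiableOn_of_addHaar_eq_zero
      (μ := volume) Real.differentiable_exp.differentiableOn h)

end GroupFourier

/-! ### Comparison of measures by trigonometric polynomials -/

section Trigonometric

theorem norm_linearCombination_sq {ι 𝓗 : Type*} [NormedAddCommGroup 𝓗]
    [InnerProductSpace ℂ 𝓗] {v : ι → 𝓗} (hv : Orthonormal ℂ v) (c : ι →₀ ℂ) :
    ‖Finsupp.linearCombination ℂ v c‖ ^ 2 = c.sum fun _ z => ‖z‖ ^ 2 := by
  have h1 := hv.inner_finsupp_eq_sum_left c c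
  rw [inner_self_eq_norm_sq_to_K] at h1
  apply Complex.ofReal_injective
  have h2 : ((‖Finsupp.linearCombination ℂ v c‖ ^ 2 : ℝ) : ℂ)
      = c.sum fun i y => (starRingEnd ℂ) y * c i := by
    rw [← h1]
    push_cast
    rfl
  rw [h2, Finsupp.sum, Finsupp.sum, Complex.ofReal_sum]
  refine Finset.sum_congr rfl fun i _ => ?_
  rw [Complex.conj_mul']
  push_cast
  rfl

theorem eLpNorm_two_eq {X F : Type*} [MeasurableSpace X] {μ : Measure X} [NormedAddCommGroup F]
    (f : X → F) : eLpNorm f 2 μ = (∫⁻ x, ‖f x‖ₑ ^ 2 ∂μ) ^ (1 / 2 : ℝ) := by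
  rw [eLpNorm_eq_lintegral_rpow_enorm_toReal (by norm_num) (by norm_num)]
  simp

/-- Finite measures on the circle are compared by their values on `‖P‖ ^ 2`, `P` a trigonometric
polynomial. -/
theorem measure_le_of_forall_trigonometric {T : ℝ} [Fact (0 < T)] {μ ν : Measure (AddCircle T)}
    [IsFiniteMeasure μ] [IsFiniteMeasure ν]
    (h : ∀ P ∈ Submodule.span ℂ (Set.range (fourier (T := T))),
      ∫⁻ x, ‖P x‖ₑ ^ 2 ∂μ ≤ ∫⁻ x, ‖P x‖ₑ ^ 2 ∂ν) : μ ≤ ν := by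
  refine Measure.le_iff.2 fun s hs => ?_
  have h1 : ∀ P ∈ Submodule.span ℂ (Set.range (fourier (T := T))),
      eLpNorm P 2 μ ≤ eLpNorm P 2 ν := by
    intro P hP
    rw [eLpNorm_two_eq, eLpNorm_two_eq]
    exact ENNReal.rpow_le_rpow (h P hP) (by norm_num)
  -- Approximation of the indicator in `L²(μ + ν)` is approximation in `L²(μ)` and `L²(ν)` by the
  -- same polynomial.
  let f : AddCircle T → ℂ := s.indicator fun _ => 1
  have hf : MemLp f 2 (μ + ν) := memLp_indicator_const 2 hs 1 (Or.inr (measure_ne_top _ _))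
  have hdense : Dense (ContinuousMap.toLp (E := ℂ) 2 (μ + ν) ℂ ''
      (Submodule.span ℂ (Set.range (fourier (T := T))) : Set C(AddCircle T, ℂ))) :=
    (ContinuousMap.toLp_denseRange ℂ (μ + ν) ℂ ENNReal.ofNat_ne_top).dense_image
      (ContinuousMap.toLp (E := ℂ) 2 (μ + ν) ℂ).continuous
      (Submodule.dense_iff_topologicalClosure_eq_top.2 span_fourier_closure_eq_top)
  have hfm : AEStronglyMeasurable f μ := hf.1.mono_ac (Measure.absolutelyContinuous_of_le (Measure.le_add_right le_rfl))
  have key : eLpNorm f 2 μ ≤ eLpNorm f 2 ν := by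
    refine ENNReal.le_of_forall_pos_le_add fun ε hε _ => ?_
    have hε' : (0 : ℝ≥0∞) < ε / 2 := ENNReal.div_pos (by simpa using hε.ne') (by norm_num)
    obtain ⟨_, ⟨P, hP, rfl⟩, hd⟩ := EMetric.mem_closure_iff.1 (hdense (hf.toLp f)) _ hε'
    have hPm : MemLp P 2 (μ + ν) :=
      (memLp_congr_ae (ContinuousMap.coeFn_toLp (𝕜 := ℂ) (μ + ν) P)).1 (Lp.memLp _)
    have hd' : eLpNorm (f - ⇑P) 2 (μ + ν) ≤ ε / 2 := by
      rw [Lp.edist_def] at hd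
      refine le_trans (eLpNorm_congr_ae ?_).le hd.le
      exact hf.coeFn_toLp.symm.sub (ContinuousMap.coeFn_toLp (𝕜 := ℂ) (μ + ν) P).symm
    have hμ : eLpNorm (f - ⇑P) 2 μ ≤ ε / 2 :=
      (eLpNorm_mono_measure _ (Measure.le_add_right le_rfl)).trans hd'
    have hν : eLpNorm (⇑P - f) 2 ν ≤ ε / 2 := by
      rw [eLpNorm_sub_comm]
      exact (eLpNorm_mono_measure _ (Measure.le_add_left le_rfl)).trans hd'
    have hPμ : AEStronglyMeasurable P μ := P.continuous.aestronglyMeasurable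
    have hPν : AEStronglyMeasurable P ν := P.continuous.aestronglyMeasurable
    have hfν : AEStronglyMeasurable f ν := aestronglyMeasurable_const.indicator hs
    calc eLpNorm f 2 μ = eLpNorm (f - ⇑P + ⇑P) 2 μ := by rw [sub_add_cancel]
      _ ≤ eLpNorm (f - ⇑P) 2 μ + eLpNorm P 2 μ := eLpNorm_add_le (hfm.sub hPμ) hPμ (by norm_num)
      _ ≤ ε / 2 + eLpNorm P 2 ν := add_le_add hμ (h1 P hP)
      _ = ε / 2 + eLpNorm (⇑P - f + f) 2 ν := by rw [sub_add_cancel]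
      _ ≤ ε / 2 + (eLpNorm (⇑P - f) 2 ν + eLpNorm f 2 ν) := by
          gcongr
          exact eLpNorm_add_le (hPν.sub hfν) hfν (by norm_num)
      _ ≤ ε / 2 + (ε / 2 + eLpNorm f 2 ν) := by gcongr
      _ = eLpNorm f 2 ν + ε := by rw [← add_assoc, ENNReal.add_halves, add_comm]
  rw [eLpNorm_indicator_const hs (by norm_num) (by norm_num),
    eLpNorm_indicator_const hs (by norm_num) (by norm_num)] at key
  simp only [enorm_one, one_mul] at key
  exact (ENNReal.rpow_le_rpow_iff (by norm_num)).1 key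

/-- The trigonometric polynomial `v ↦ ∑ p, c p exp (-2πi b p v)`. -/
noncomputable def trigPoly (b : ℝ) (c : ℤ →₀ ℂ) (v : ℝ) : ℂ :=
  c.sum fun p z => z * Complex.exp (-(2 * Real.pi * Complex.I * ((b * p * v : ℝ) : ℂ)))

theorem continuous_trigPoly (b : ℝ) (c : ℤ →₀ ℂ) : Continuous (trigPoly b c) := by
  unfold trigPoly Finsupp.sum
  fun_prop

theorem trigPoly_eq_sum_fourier {b : ℝ} (c : ℤ →₀ ℂ) (v : ℝ) :
    (c.sum fun i a => a • fourier (T := 1 / b) (-i)) (v : AddCircle (1 / b)) = trigPoly b c v := by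
  rw [trigPoly, Finsupp.sum, Finsupp.sum, ContinuousMap.sum_apply]
  refine Finset.sum_congr rfl fun p _ => ?_
  rw [ContinuousMap.smul_apply, fourier_coe_apply, smul_eq_mul]
  congr 2
  push_cast
  rw [one_div, div_inv_eq_mul]
  ring

/-- The measures with densities `w₁`, `w₂` are pushed to the circle of length `1/b` and compared
there; an inequality of measures gives one of densities. -/
theorem ae_le_of_forall_trigPoly {b : ℝ} (hb : 0 < b) {w₁ w₂ : ℝ → ℝ≥0∞} (hw₁ : Measurable w₁)
    (hw₂ : Measurable w₂) (hf₁ : ∫⁻ v in Set.Ioo 0 (1 / b), w₁ v ≠ ∞)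
    (hf₂ : ∫⁻ v in Set.Ioo 0 (1 / b), w₂ v ≠ ∞)
    (h : ∀ c : ℤ →₀ ℂ, ∫⁻ v in Set.Ioo 0 (1 / b), ‖trigPoly b c v‖ₑ ^ 2 * w₁ v
      ≤ ∫⁻ v in Set.Ioo 0 (1 / b), ‖trigPoly b c v‖ₑ ^ 2 * w₂ v) :
    ∀ᵐ v ∂(volume.restrict (Set.Ioo 0 (1 / b))), w₁ v ≤ w₂ v := by
  have hT : Fact (0 < 1 / b) := ⟨by positivity⟩
  let m : (ℝ → ℝ≥0∞) → Measure (AddCircle (1 / b)) := fun w =>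
    ((volume.restrict (Set.Ioo 0 (1 / b))).withDensity w).map fun v : ℝ => (v : AddCircle (1 / b))
  have hmk : Measurable fun v : ℝ => (v : AddCircle (1 / b)) := AddCircle.measurable_mk'
  have hm : ∀ {w}, Measurable w → ∀ {g : AddCircle (1 / b) → ℝ≥0∞}, Measurable g →
      ∫⁻ x, g x ∂(m w) = ∫⁻ v in Set.Ioo 0 (1 / b), g (v : AddCircle (1 / b)) * w v := by
    intro w hw g hg
    rw [lintegral_map hg hmk, lintegral_withDensity_eq_lintegral_mul _ hw
      (show Measurable fun v : ℝ => g (v : AddCircle (1 / b)) from hg.comp hmk)]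
    refine lintegral_congr fun v => ?_
    rw [Pi.mul_apply, mul_comm]
  have hfin : ∀ {w}, ∫⁻ v in Set.Ioo 0 (1 / b), w v ≠ ∞ → IsFiniteMeasure (m w) := by
    intro w hw
    have := isFiniteMeasure_withDensity hw
    infer_instance
  have := hfin hf₁
  have := hfin hf₂
  have hle : m w₁ ≤ m w₂ := by
    refine measure_le_of_forall_trigonometric fun P hP => ?_
    -- `trigPoly` carries the frequencies `-p`, so the characters are reindexed by negation.
    have hr : Set.range (fourier (T := 1 / b)) = Set.range fun p : ℤ => fourier (T := 1 / b) (-p) :=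
      ((Equiv.neg ℤ).surjective.range_comp _).symm
    rw [hr, Finsupp.mem_span_range_iff_exists_finsupp] at hP
    obtain ⟨c, rfl⟩ := hP
    have hg : Measurable fun x : AddCircle (1 / b) =>
        ‖(c.sum fun i a => a • fourier (T := 1 / b) (-i)) x‖ₑ ^ 2 :=
      (ContinuousMap.continuous _).measurable.enorm.pow_const 2
    rw [hm hw₁ hg, hm hw₂ hg]
    simp_rw [trigPoly_eq_sum_fourier]
    exact h c
  refine ae_le_of_forall_setLIntegral_le_of_sigmaFinite₀ hw₁.aemeasurable fun s hs _ => ?_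
  -- The subset of the circle whose representatives in `(0, 1/b]` lie in `s`; its pushed measure is
  -- the integral of the density over `s`.
  let E : Set (AddCircle (1 / b)) :=
    {x | ((AddCircle.measurableEquivIoc (1 / b) 0 x : Set.Ioc (0 : ℝ) (0 + 1 / b)) : ℝ) ∈ s}
  have hE : MeasurableSet E :=
    (measurable_subtype_coe.comp (AddCircle.measurableEquivIoc (1 / b) 0).measurable) hs
  have hmE : ∀ w, m w E = ∫⁻ v in s, w v ∂(volume.restrict (Set.Ioo 0 (1 / b))) := by
    intro w
    rw [Measure.map_apply hmk hE, ← withDensity_apply _ hs]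
    refine measure_congr ((withDensity_absolutelyContinuous _ _).ae_le ?_)
    filter_upwards [ae_restrict_mem measurableSet_Ioo] with v hv
    have h1 : AddCircle.measurableEquivIoc (1 / b) 0 (v : AddCircle (1 / b))
        = ⟨v, hv.1, by rw [zero_add]; exact hv.2.le⟩ :=
      (AddCircle.equivIoc (1 / b) 0).eq_symm_apply.1 rfl
    apply propext
    change ((AddCircle.measurableEquivIoc (1 / b) 0 (v : AddCircle (1 / b)) :
      Set.Ioc (0 : ℝ) (0 + 1 / b)) : ℝ) ∈ s ↔ v ∈ s
    rw [h1]
  rw [← hmE, ← hmE]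
  exact hle E

/-- The characters are orthonormal for normalized Haar measure, and the circle has length `b⁻¹`:
this is the origin of `b` in the bounds. -/
theorem lintegral_trigPoly {b : ℝ} (hb : 0 < b) (c : ℤ →₀ ℂ) :
    ∫⁻ v in Set.Ioo 0 (1 / b), ‖trigPoly b c v‖ₑ ^ 2
      = ENNReal.ofReal (b⁻¹ * c.sum fun _ z => ‖z‖ ^ 2) := by
  have hT : Fact (0 < 1 / b) := ⟨by positivity⟩
  let P : C(AddCircle (1 / b), ℂ) := c.sum fun i a => a • fourier (T := 1 / b) (-i)
  let f := Finsupp.linearCombination ℂ (fun i : ℤ => fourierLp (T := 1 / b) 2 (-i)) c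
  have hf : f = ContinuousMap.toLp 2 AddCircle.haarAddCircle ℂ P := by
    simp only [f, P, Finsupp.linearCombination_apply, Finsupp.sum, map_sum, map_smul]
  have h1 : ‖f‖ ^ 2 = c.sum fun _ z => ‖z‖ ^ 2 :=
    norm_linearCombination_sq ((orthonormal_fourier (T := 1 / b)).comp _ neg_injective) c
  have h2 : ∫⁻ x, ‖P x‖ₑ ^ 2 ∂AddCircle.haarAddCircle = ENNReal.ofReal (c.sum fun _ z => ‖z‖ ^ 2) := by
    rw [← h1, ENNReal.ofReal_pow (norm_nonneg _), ofReal_norm, ← lintegral_enorm_sq_coeFn, hf]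
    refine lintegral_congr_ae ?_
    filter_upwards [ContinuousMap.coeFn_toLp (p := 2) (𝕜 := ℂ) AddCircle.haarAddCircle P] with x hx
    rw [hx]
  have h3 := AddCircle.lintegral_preimage (1 / b) 0 fun x => ‖P x‖ₑ ^ 2
  rw [AddCircle.volume_eq_smul_haarAddCircle, lintegral_smul_measure, h2, zero_add,
    Measure.restrict_congr_set Ioo_ae_eq_Ioc.symm] at h3
  simp only [P, trigPoly_eq_sum_fourier] at h3
  rw [h3, one_div, smul_eq_mul, ENNReal.ofReal_mul (by positivity)]

end Trigonometric
/-! ### Riesz sequences from their bounds -/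

section RieszBounds

variable {ι 𝓗 : Type*} [NormedAddCommGroup 𝓗] [InnerProductSpace ℂ 𝓗]

theorem linearIndependent_of_lower_bound {f : ι → 𝓗} {A : ℝ} (hA : 0 < A)
    (h : ∀ c : ι →₀ ℂ, A * (c.sum fun _ z => ‖z‖ ^ 2) ≤ ‖Finsupp.linearCombination ℂ f c‖ ^ 2) :
    LinearIndependent ℂ f := by
  rw [linearIndependent_iff]
  intro c hc
  have h1 := h c
  rw [hc, norm_zero] at h1
  have h2 : (c.sum fun _ z => ‖z‖ ^ 2) ≤ 0 := by
    by_contra! h3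
    have := mul_pos hA h3
    norm_num at h1
    linarith
  have h3 := (Finset.sum_eq_zero_iff_of_nonneg (fun i _ => by positivity)).1
    (le_antisymm h2 (Finset.sum_nonneg fun i _ => by positivity))
  ext i
  by_cases hi : i ∈ c.support
  · simpa using h3 i hi
  · simpa using hi

/-- The definition of a Riesz sequence asks for a basis indexed by `ι` itself. Gram--Schmidt along
an enumeration of `ι` keeps the index set, and linear independence ensures that no vector becomes
zero. -/
theorem exists_hilbertBasis_of_linearIndependent [Countable ι] [Infinite ι] [CompleteSpace 𝓗]
    {f : ι → 𝓗} (hf : LinearIndependent ℂ f)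
    (hd : Dense (Submodule.span ℂ (Set.range f) : Set 𝓗)) : Nonempty (HilbertBasis ι ℂ 𝓗) := by
  obtain ⟨_⟩ := nonempty_denumerable ι
  let σ : ι ≃ ℕ := Denumerable.eqv ι
  let v : ι → 𝓗 := InnerProductSpace.gramSchmidtNormed ℂ (f ∘ σ.symm) ∘ σ
  have hv : Orthonormal ℂ v :=
    (InnerProductSpace.gramSchmidtNormed_orthonormal (hf.comp _ σ.symm.injective)).comp _
      σ.injective
  have hspan : Submodule.span ℂ (Set.range v) = Submodule.span ℂ (Set.range f) := by
    rw [σ.surjective.range_comp, InnerProductSpace.span_gramSchmidtNormed_range,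
      InnerProductSpace.span_gramSchmidt, σ.symm.surjective.range_comp]
  exact ⟨HilbertBasis.mk hv
    (by rw [hspan, Submodule.dense_iff_topologicalClosure_eq_top.1 hd])⟩

/-- The upper bound makes `e i ↦ f i` bounded on finite combinations and the lower bound does so for
its inverse; both spans are dense. -/
theorem exists_equiv_hilbertBasis [CompleteSpace 𝓗] (e : HilbertBasis ι ℂ 𝓗)
    {f : ι → 𝓗} {A B : ℝ} (hA : 0 < A) (hB : 0 < B)
    (hd : Dense (Submodule.span ℂ (Set.range f) : Set 𝓗))
    (h : ∀ c : ι →₀ ℂ, A * (c.sum fun _ z => ‖z‖ ^ 2) ≤ ‖Finsupp.linearCombination ℂ f c‖ ^ 2 ∧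
      ‖Finsupp.linearCombination ℂ f c‖ ^ 2 ≤ B * (c.sum fun _ z => ‖z‖ ^ 2)) :
    ∃ U : 𝓗 ≃L[ℂ] 𝓗, ∀ i, U (e i) = f i := by
  have hd1 : DenseRange (Finsupp.linearCombination ℂ e) := by
    have h1 := Submodule.dense_iff_topologicalClosure_eq_top.2 e.dense_span
    rw [← Finsupp.range_linearCombination] at h1
    exact h1
  have hd2 : DenseRange (Finsupp.linearCombination ℂ f) := by
    rw [← Finsupp.range_linearCombination] at hd
    exact hd
  have hb1 : ∃ C, ∀ c : ι →₀ ℂ, ‖Finsupp.linearCombination ℂ f (LinearEquiv.refl ℂ (ι →₀ ℂ) c)‖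
      ≤ C * ‖Finsupp.linearCombination ℂ e c‖ := by
    refine ⟨√B, fun c => ?_⟩
    rw [LinearEquiv.refl_apply, ← Real.sqrt_sq (norm_nonneg (Finsupp.linearCombination ℂ e c)),
      ← Real.sqrt_mul hB.le]
    refine Real.le_sqrt_of_sq_le ?_
    rw [norm_linearCombination_sq e.orthonormal]
    exact (h c).2
  have hb2 : ∃ C, ∀ c : ι →₀ ℂ,
      ‖Finsupp.linearCombination ℂ e ((LinearEquiv.refl ℂ (ι →₀ ℂ)).symm c)‖
        ≤ C * ‖Finsupp.linearCombination ℂ f c‖ := by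
    refine ⟨√A⁻¹, fun c => ?_⟩
    rw [← Real.sqrt_sq (norm_nonneg (Finsupp.linearCombination ℂ f c)),
      ← Real.sqrt_mul (inv_pos.2 hA).le]
    refine Real.le_sqrt_of_sq_le ?_
    rw [LinearEquiv.refl_symm, LinearEquiv.refl_apply,
      norm_linearCombination_sq e.orthonormal, le_inv_mul_iff₀ hA]
    exact (h c).1
  refine ⟨(LinearEquiv.refl ℂ (ι →₀ ℂ)).extend (Finsupp.linearCombination ℂ e)
    (Finsupp.linearCombination ℂ f) hd1 hb1 hd2 hb2, fun i => ?_⟩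
  have h1 := LinearEquiv.extend_eq (LinearEquiv.refl ℂ (ι →₀ ℂ)) _ _ hd1 hb1 hd2 hb2
    (Finsupp.single i 1)
  simp only [Finsupp.linearCombination_single, one_smul, LinearEquiv.refl_apply] at h1
  exact h1

/-- For a sequence, the two bounds imply the Riesz property. -/
theorem isRieszSequence_of_bounds [Countable ι] [Infinite ι] [CompleteSpace 𝓗] {f : ι → 𝓗}
    {A B : ℝ} (hA : 0 < A) (hB : 0 < B)
    (h : ∀ c : ι →₀ ℂ, A * (c.sum fun _ z => ‖z‖ ^ 2) ≤ ‖c.sum fun i z => z • f i‖ ^ 2 ∧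
      ‖c.sum fun i z => z • f i‖ ^ 2 ≤ B * (c.sum fun _ z => ‖z‖ ^ 2)) : IsRieszSequence f := by
  let K := (Submodule.span ℂ (Set.range f)).topologicalClosure
  let f' : ι → K := fun i =>
    ⟨f i, Submodule.le_topologicalClosure _ (Submodule.subset_span ⟨i, rfl⟩)⟩
  have hK : CompleteSpace K := (Submodule.isClosed_topologicalClosure _).completeSpace_coe
  have h' : ∀ c : ι →₀ ℂ, A * (c.sum fun _ z => ‖z‖ ^ 2) ≤ ‖Finsupp.linearCombination ℂ f' c‖ ^ 2 ∧
      ‖Finsupp.linearCombination ℂ f' c‖ ^ 2 ≤ B * (c.sum fun _ z => ‖z‖ ^ 2) := by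
    intro c
    have : ‖Finsupp.linearCombination ℂ f' c‖ = ‖c.sum fun i z => z • f i‖ := by
      have h1 : (Finsupp.linearCombination ℂ f' c : 𝓗) = c.sum fun i z => z • f i := by
        rw [Finsupp.linearCombination_apply, Finsupp.sum, Submodule.coe_sum, Finsupp.sum]
        rfl
      rw [← h1]
      rfl
    rw [this]
    exact h c
  have hdense : Dense (Submodule.span ℂ (Set.range f') : Set K) := by
    intro x
    rw [closure_subtype]
    have hx : (x : 𝓗) ∈ closure (Submodule.span ℂ (Set.range f) : Set 𝓗) := x.2
    convert hx
    have h1 : Submodule.map K.subtype (Submodule.span ℂ (Set.range f'))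
        = Submodule.span ℂ (Set.range f) := by
      rw [Submodule.map_span, ← Set.range_comp]
      rfl
    rw [← h1]
    rfl
  obtain ⟨e⟩ := exists_hilbertBasis_of_linearIndependent
    (linearIndependent_of_lower_bound hA fun c => (h' c).1) hdense
  obtain ⟨U, hU⟩ := exists_equiv_hilbertBasis e hA hB hdense h'
  exact ⟨e, U, fun i => congrArg Subtype.val (hU i)⟩

end RieszBounds

/-! ### The Gabor system on the Fourier side -/

section GaborSystem

variable {n : ℕ}

/-- The Fourier transform `𝒢̂_{k,l,m}(e^v, j)`. -/
noncomputable def gaborFourier (a : ℝ) (G : L2HS n) (q : GaborIdx n) (j : ℤˣ) (v : ℝ) : HS (L2Rn n) :=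
  groupFourier (modulated a G q) (Real.exp v) j

/-- `w_{g_{k,l,m}}(e^v)`. -/
noncomputable def logWeight (a b : ℝ) (G : L2HS n) (q : GaborIdx n) (v : ℝ) : ℝ≥0∞ :=
  ∑ j : ℤˣ, ∑' s : ℤ, ‖gaborFourier a G q j (v + s / b)‖ₑ ^ 2

theorem stronglyMeasurable_gaborFourier (a : ℝ) (G : L2HS n) (q : GaborIdx n) (j : ℤˣ) :
    StronglyMeasurable (gaborFourier a G q j) :=
  stronglyMeasurable_groupFourier_exp _ j

theorem measurable_logWeight (a b : ℝ) (G : L2HS n) (q : GaborIdx n) :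
    Measurable (logWeight a b G q) := by
  refine Finset.measurable_sum _ fun j _ => Measurable.tsum fun s => ?_
  exact ((stronglyMeasurable_gaborFourier a G q j).comp_measurable
    (by fun_prop : Measurable fun v : ℝ => v + s / b)).enorm.pow_const 2

theorem mul_exp_eq_exp_log_add {ν : ℝ} (hν : 0 < ν) (r : ℝ) :
    ν * Real.exp r = Real.exp (Real.log ν + r) := by
  rw [Real.exp_add, Real.exp_log hν]

theorem inner_gaborSymbol (a : ℝ) (G : L2HS n) (q q' : GaborIdx n) {ν : ℝ} (hν : 0 < ν) (r : ℝ)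
    (j : ℤˣ) : inner ℂ (gaborSymbol a G q (ν * Real.exp r) j) (gaborSymbol a G q' (ν * Real.exp r) j)
      = inner ℂ (gaborFourier a G q j (Real.log ν + r)) (gaborFourier a G q' j (Real.log ν + r)) := by
  rw [gaborSymbol, gaborSymbol, inner_weylInverse, mul_exp_eq_exp_log_add hν, gaborFourier,
    gaborFourier]

theorem gaborWeight_eq_logWeight (a b : ℝ) (G : L2HS n) (q : GaborIdx n) {ν : ℝ} (hν : 0 < ν) :
    gaborWeight a b G q ν = logWeight a b G q (Real.log ν) := by
  refine Finset.sum_congr rfl fun j _ => tsum_congr fun s => ?_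
  rw [gaborSymbol, mul_exp_eq_exp_log_add hν, ← ofReal_norm, norm_weylInverse, ofReal_norm,
    gaborFourier]

theorem ae_Ioo_congr_log {T : ℝ} {p p' : ℝ → Prop} (h : ∀ ν, 0 < ν → (p ν ↔ p' (Real.log ν))) :
    (∀ᵐ ν ∂(volume.restrict (Set.Ioo 1 (Real.exp T))), p ν) ↔
      ∀ᵐ v ∂(volume.restrict (Set.Ioo 0 T)), p' v := by
  rw [← ae_Ioo_log_iff]
  refine Filter.eventually_congr ?_
  filter_upwards [ae_restrict_mem measurableSet_Ioo] with ν hν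
  exact h ν (by linarith [hν.1])

theorem coeFn_translation_exp (t : ℝ) (F : L2HS n) :
    ∀ᵐ x ∂haarMul, translation (Units.mk0 (Real.exp t) (Real.exp_ne_zero t)) F x
      = F (x / Real.exp t) :=
  Lp.coeFn_compMeasurePreserving F (measurePreserving_div (Units.mk0 (Real.exp t) (Real.exp_ne_zero t)))

theorem groupFourier_gaborSystem (a b : ℝ) (G : L2HS n) (q : GaborIdx n) (p : ℤ) (j : ℤˣ) :
    ∀ᵐ v, groupFourier (gaborSystem a b G (q, p)) (Real.exp v) j
      = Complex.exp (-(2 * Real.pi * Complex.I * ((b * p * v : ℝ) : ℂ))) • gaborFourier a G q j v :=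
  groupFourier_translate (b * p) (coeFn_translation_exp (b * p) (modulated a G q)) j

/-- Pointwise, `groupFourier` is linear only almost everywhere; linearity is taken from
`groupFourierL2`, and the countably many `p` share one null set. -/
theorem groupFourier_sum_gaborSystem (a b : ℝ) (G : L2HS n) (q : GaborIdx n) (c : ℤ →₀ ℂ) (j : ℤˣ) :
    ∀ᵐ v, groupFourier (c.sum fun p z => z • gaborSystem a b G (q, p)) (Real.exp v) j
      = trigPoly b c v • gaborFourier a G q j v := by
  have h1 := coeFn_groupFourierL2 j (c.sum fun p z => z • gaborSystem a b G (q, p))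
  have h2 := ae_all_iff.2 fun p => groupFourier_gaborSystem a b G q p j
  have h3 := ae_all_iff.2 fun p => coeFn_groupFourierL2 j (gaborSystem a b G (q, p))
  have h4 := ae_all_iff.2 fun p =>
    Lp.coeFn_smul (c p) (groupFourierL2 j (gaborSystem a b G (q, p)))
  have h5 := Lp.coeFn_fun_finsetSum c.support fun p =>
    c p • groupFourierL2 j (gaborSystem a b G (q, p))
  have h6 : groupFourierL2 j (c.sum fun p z => z • gaborSystem a b G (q, p))
      = ∑ p ∈ c.support, c p • groupFourierL2 j (gaborSystem a b G (q, p)) := by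
    simp only [Finsupp.sum, map_sum, map_smul]
  filter_upwards [h1, h2, h3, h4, h5] with v h1 h2 h3 h4 h5
  rw [← h1, h6, h5, trigPoly, Finsupp.sum, Finset.sum_smul]
  refine Finset.sum_congr rfl fun p _ => ?_
  rw [h4, Pi.smul_apply, h3, h2, smul_smul]

theorem exp_neg_add_int_div {b : ℝ} (hb : 0 < b) (p s : ℤ) (v : ℝ) :
    Complex.exp (-(2 * Real.pi * Complex.I * ((b * p * (v + s / b) : ℝ) : ℂ)))
      = Complex.exp (-(2 * Real.pi * Complex.I * ((b * p * v : ℝ) : ℂ))) := by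
  rw [Complex.exp_eq_exp_iff_exists_int]
  -- The exponents differ by `-2πi b p (s / b) = -2πi p s`.
  refine ⟨-(p * s), ?_⟩
  have : (b : ℂ) ≠ 0 := by exact_mod_cast hb.ne'
  push_cast
  field_simp
  ring

theorem trigPoly_add_int_div {b : ℝ} (hb : 0 < b) (c : ℤ →₀ ℂ) (s : ℤ) (v : ℝ) :
    trigPoly b c (v + s / b) = trigPoly b c v := by
  unfold trigPoly
  simp only [exp_neg_add_int_div hb]

/-- Plancherel on `ℝ^*`, the source of the factor `2`, followed by periodization: having period
`1/b`, the polynomial leaves the sum over `s`, and what remains is the weight. -/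
theorem lintegral_trigPoly_mul_logWeight (a : ℝ) {b : ℝ} (hb : 0 < b) (G : L2HS n) (q : GaborIdx n)
    (c : ℤ →₀ ℂ) :
    ∫⁻ v in Set.Ioo 0 (1 / b), ‖trigPoly b c v‖ₑ ^ 2 * logWeight a b G q v
      = 2 * ‖c.sum fun p z => z • gaborSystem a b G (q, p)‖ₑ ^ 2 := by
  have hP := (continuous_trigPoly b c).measurable
  have hg := fun j => (stronglyMeasurable_gaborFourier a G q j).enorm
  rw [← lintegral_groupFourier_sq]
  have h1 : ∀ j, ∫⁻ v, ‖groupFourier (c.sum fun p z => z • gaborSystem a b G (q, p)) (Real.exp v) j‖ₑ ^ 2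
      = ∫⁻ v in Set.Ioo 0 (1 / b), ∑' s : ℤ,
        ‖trigPoly b c v‖ₑ ^ 2 * ‖gaborFourier a G q j (v + s / b)‖ₑ ^ 2 := by
    intro j
    calc _ = ∫⁻ v, ‖trigPoly b c v‖ₑ ^ 2 * ‖gaborFourier a G q j v‖ₑ ^ 2 := by
          refine lintegral_congr_ae ?_
          filter_upwards [groupFourier_sum_gaborSystem a b G q c j] with v hv
          rw [hv, enorm_smul, mul_pow]
      _ = _ := by
          rw [lintegral_eq_lintegral_tsum hb
            (show Measurable fun v => ‖trigPoly b c v‖ₑ ^ 2 * ‖gaborFourier a G q j v‖ₑ ^ 2 from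
              (hP.enorm.pow_const 2).mul ((hg j).pow_const 2))]
          simp_rw [trigPoly_add_int_div hb]
  simp_rw [h1]
  have hm : ∀ j, Measurable fun v => ∑' s : ℤ,
      ‖trigPoly b c v‖ₑ ^ 2 * ‖gaborFourier a G q j (v + s / b)‖ₑ ^ 2 := fun j =>
    Measurable.tsum fun s => (hP.enorm.pow_const 2).mul
      (((hg j).comp (by fun_prop : Measurable fun v : ℝ => v + s / b)).pow_const 2)
  rw [← lintegral_finsetSum _ fun j _ => hm j]
  refine lintegral_congr fun v => ?_
  simp_rw [ENNReal.tsum_mul_left]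
  rw [logWeight, Finset.mul_sum]

theorem lintegral_logWeight_ne_top (a : ℝ) {b : ℝ} (hb : 0 < b) (G : L2HS n) (q : GaborIdx n) :
    ∫⁻ v in Set.Ioo 0 (1 / b), logWeight a b G q v ≠ ∞ := by
  -- The constant polynomial `1` expresses the total mass of the weight as twice a squared norm.
  have h := lintegral_trigPoly_mul_logWeight a hb G q (Finsupp.single 0 1)
  have h1 : ∀ v, trigPoly b (Finsupp.single 0 1) v = 1 := by
    intro v
    simp [trigPoly]
  simp only [h1, enorm_one, one_pow, one_mul] at h
  rw [h]
  exact ENNReal.mul_ne_top (by norm_num) (by simp)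

/-! #### Orthogonality -/

theorem ae_sum_tsum_inner_eq_zero {a b : ℝ} {G : L2HS n} (h : FibrewiseOrthogonalSymbols a b G)
    {q q' : GaborIdx n} (hq : q ≠ q') :
    ∀ᵐ v ∂(volume.restrict (Set.Ioo 0 (1 / b))), ∑ j : ℤˣ, ∑' s : ℤ,
      inner ℂ (gaborFourier a G q j (v + s / b)) (gaborFourier a G q' j (v + s / b)) = 0 := by
  refine (ae_Ioo_congr_log (p := fun ν => ∑ j : ℤˣ, ∑' s : ℤ,
    inner ℂ (gaborSymbol a G q (ν * Real.exp (s / b)) j)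
      (gaborSymbol a G q' (ν * Real.exp (s / b)) j) = 0) fun ν hν => ?_).1 ?_
  · simp_rw [inner_gaborSymbol a G q q' hν]
  · filter_upwards [h] with ν hν
    exact hν q q' hq

/-- On the Fourier side the inner product is half the integral of the character `χ` times a sum over
`j`. As `χ` has period `1/b`, periodization leaves `χ` times the sum over `j` and `s` that vanishes
by hypothesis. -/
theorem inner_gaborSystem_eq_zero {a b : ℝ} (hb : 0 < b) {G : L2HS n}
    (h : FibrewiseOrthogonalSymbols a b G) {q q' : GaborIdx n} (hq : q ≠ q') (p p' : ℤ) :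
    inner ℂ (gaborSystem a b G (q, p)) (gaborSystem a b G (q', p')) = 0 := by
  let e : ℤ → ℝ → ℂ := fun p v => Complex.exp (-(2 * Real.pi * Complex.I * ((b * p * v : ℝ) : ℂ)))
  let χ : ℝ → ℂ := fun v => (starRingEnd ℂ) (e p v) * e p' v
  have hχ : ∀ v (s : ℤ), χ (v + s / b) = χ v := fun v s => by
    simp only [χ, e, exp_neg_add_int_div hb]
  let Φ : ℤˣ → ℝ → ℂ := fun j v => inner ℂ (gaborFourier a G q j v) (gaborFourier a G q' j v)
  have hΦi : ∀ j, Integrable (Φ j) := fun j => integrable_inner_groupFourier j _ _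
  have hΦm : ∀ j, StronglyMeasurable (Φ j) := fun j =>
    (stronglyMeasurable_gaborFourier a G q j).inner (stronglyMeasurable_gaborFourier a G q' j)
  have hχc : Continuous χ := by
    simp only [χ, e]
    fun_prop
  have hχn : ∀ v, ‖χ v‖ ≤ 1 := fun v => by
    simp only [χ, e]
    rw [norm_mul, RCLike.norm_conj, norm_phase, norm_phase, one_mul]
  let Ψ : ℝ → ℂ := fun v => χ v * ∑ j, Φ j v
  have hint : ∀ j, Integrable fun v => χ v * Φ j v := fun j =>
    (hΦi j).bdd_mul hχc.aestronglyMeasurable (Filter.Eventually.of_forall hχn)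
  have hΨi : Integrable Ψ := by
    simp only [Ψ, Finset.mul_sum]
    exact integrable_finsetSum _ fun j _ => hint j
  have hΨm : StronglyMeasurable Ψ :=
    hχc.stronglyMeasurable.mul (Finset.stronglyMeasurable_fun_sum _ fun j _ => hΦm j)
  have h1 : inner ℂ (gaborSystem a b G (q, p)) (gaborSystem a b G (q', p')) = 1 / 2 * ∫ v, Ψ v := by
    rw [inner_eq_half_sum_groupFourierL2]
    simp only [Ψ, Finset.mul_sum]
    rw [integral_finsetSum _ fun j _ => hint j, Finset.mul_sum]
    refine Finset.sum_congr rfl fun j _ => ?_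
    rw [inner_groupFourierL2]
    congr 1
    refine integral_congr_ae ?_
    filter_upwards [groupFourier_gaborSystem a b G q p j, groupFourier_gaborSystem a b G q' p' j]
      with v h1 h2
    rw [h1, h2, inner_smul_left, inner_smul_right, ← mul_assoc]
  rw [h1, integral_eq_integral_tsum hb hΨi hΨm]
  -- Summability for each `j` is needed to exchange the sum over `s` with the one over `j`.
  have h2 := ae_all_iff.2 fun j => ae_summable_enorm hb (hΦi j) (hΦm j)
  have h3 : ∫ v in Set.Ioo 0 (1 / b), ∑' s : ℤ, Ψ (v + s / b) = ∫ v in Set.Ioo 0 (1 / b), (0 : ℂ) := by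
    refine integral_congr_ae ?_
    filter_upwards [ae_sum_tsum_inner_eq_zero h hq, h2] with v hv hs
    simp only [Ψ, hχ]
    rw [tsum_mul_left, Summable.tsum_finsetSum fun j _ => hs j]
    exact mul_eq_zero_of_right _ hv
  rw [h3, integral_zero, mul_zero]

/-! ### Reduction of the bounds to a single `(k, l, m)`. -/

theorem norm_sum_sq_of_pairwise_inner_eq_zero {κ 𝓗 : Type*} [NormedAddCommGroup 𝓗]
    [InnerProductSpace ℂ 𝓗] (s : Finset κ) {F : κ → 𝓗}
    (h : ∀ i j, i ≠ j → inner ℂ (F i) (F j) = 0) : ‖∑ i ∈ s, F i‖ ^ 2 = ∑ i ∈ s, ‖F i‖ ^ 2 := by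
  classical
  induction s using Finset.induction_on with
  | empty => simp
  | insert i s hi ih =>
    rw [Finset.sum_insert hi, Finset.sum_insert hi, ← ih, pow_two, pow_two, pow_two]
    refine norm_add_sq_eq_norm_sq_add_norm_sq_of_inner_eq_zero (𝕜 := ℂ) _ _ ?_
    rw [inner_sum]
    exact Finset.sum_eq_zero fun j hj => h i j fun hij => hi (hij ▸ hj)

theorem norm_sum_gaborSystem_sq {a b : ℝ} (hb : 0 < b) {G : L2HS n}
    (h : FibrewiseOrthogonalSymbols a b G) (c : GaborIdx n × ℤ →₀ ℂ) :
    ‖c.sum fun i z => z • gaborSystem a b G i‖ ^ 2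
      = c.curry.sum fun q d => ‖d.sum fun p z => z • gaborSystem a b G (q, p)‖ ^ 2 := by
  have h1 := Finsupp.sum_curry_index c fun q p z => z • gaborSystem a b G (q, p)
  simp only [Prod.mk.eta] at h1
  rw [← h1]
  refine norm_sum_sq_of_pairwise_inner_eq_zero _
    (F := fun q => (c.curry q).sum fun p z => z • gaborSystem a b G (q, p)) fun q q' hq => ?_
  simp only [Finsupp.sum, sum_inner, inner_sum, inner_smul_left, inner_smul_right,
    inner_gaborSystem_eq_zero hb h hq, mul_zero, Finset.sum_const_zero]

/-- By orthogonality of the blocks both the squared norm and `∑ |c|²` are sums over `q`, so bounds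
for each block add up. -/
theorem bounds_iff {a b : ℝ} (hb : 0 < b) {G : L2HS n} (h : FibrewiseOrthogonalSymbols a b G)
    (A B : ℝ) :
    (∀ c : GaborIdx n × ℤ →₀ ℂ, A * (c.sum fun _ z => ‖z‖ ^ 2)
        ≤ ‖c.sum fun i z => z • gaborSystem a b G i‖ ^ 2 ∧
      ‖c.sum fun i z => z • gaborSystem a b G i‖ ^ 2 ≤ B * (c.sum fun _ z => ‖z‖ ^ 2)) ↔
    ∀ (q : GaborIdx n) (d : ℤ →₀ ℂ), A * (d.sum fun _ z => ‖z‖ ^ 2)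
        ≤ ‖d.sum fun p z => z • gaborSystem a b G (q, p)‖ ^ 2 ∧
      ‖d.sum fun p z => z • gaborSystem a b G (q, p)‖ ^ 2 ≤ B * (d.sum fun _ z => ‖z‖ ^ 2) := by
  constructor
  · intro H q d
    -- Conversely, a sequence supported on the block of `q` isolates that block.
    have h1 := H (d.embDomain ⟨fun p => (q, p), fun p p' hp => (Prod.mk.inj hp).2⟩)
    simp only [Finsupp.sum_embDomain] at h1
    exact h1
  · intro H c
    rw [norm_sum_gaborSystem_sq hb h, ← Finsupp.sum_curry_index c fun _ _ z => ‖z‖ ^ 2,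
      Finsupp.mul_sum, Finsupp.mul_sum]
    exact ⟨Finset.sum_le_sum fun q _ => (H q _).1, Finset.sum_le_sum fun q _ => (H q _).2⟩

/-! ### Bounds for one block and bounds for its weight. -/

theorem lintegral_trigPoly_mul_const {b : ℝ} (hb : 0 < b) (d : ℤ →₀ ℂ) {C : ℝ} (hC : 0 < C) :
    ∫⁻ v in Set.Ioo 0 (1 / b), ‖trigPoly b d v‖ₑ ^ 2 * ENNReal.ofReal (2 * C * b)
      = ENNReal.ofReal (2 * (C * d.sum fun _ z => ‖z‖ ^ 2)) := by
  rw [lintegral_mul_const _ ((continuous_trigPoly b d).measurable.enorm.pow_const 2),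
    lintegral_trigPoly hb, ← ENNReal.ofReal_mul' (by positivity)]
  congr 1
  field_simp

theorem two_mul_enorm_sq {F : Type*} [NormedAddCommGroup F] (x : F) :
    2 * ‖x‖ₑ ^ 2 = ENNReal.ofReal (2 * ‖x‖ ^ 2) := by
  rw [ENNReal.ofReal_mul (by norm_num), ENNReal.ofReal_pow (norm_nonneg _), ofReal_norm,
    ENNReal.ofReal_ofNat]

theorem lintegral_const_Ioo_ne_top (b C : ℝ) :
    ∫⁻ _ in Set.Ioo 0 (1 / b), ENNReal.ofReal C ≠ ∞ := by
  rw [lintegral_const]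
  exact ENNReal.mul_ne_top ENNReal.ofReal_ne_top (measure_ne_top _ _)

theorem sum_norm_sq_nonneg {κ : Type*} (d : κ →₀ ℂ) : 0 ≤ d.sum fun _ z => ‖z‖ ^ 2 :=
  Finset.sum_nonneg fun _ _ => by positivity

/-- Twice each side is the integral of `|P_d|²` against a weight: the constant `2Ab`, whose `b`
cancels the length `b⁻¹`, and `logWeight`. Inequality for all `d` is then comparison of the weights.
-/
theorem lower_bound_iff (a : ℝ) {b : ℝ} (hb : 0 < b) (G : L2HS n) (q : GaborIdx n) {A : ℝ}
    (hA : 0 < A) :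
    (∀ d : ℤ →₀ ℂ, A * (d.sum fun _ z => ‖z‖ ^ 2)
        ≤ ‖d.sum fun p z => z • gaborSystem a b G (q, p)‖ ^ 2) ↔
      ∀ᵐ v ∂(volume.restrict (Set.Ioo 0 (1 / b))),
        ENNReal.ofReal (2 * A * b) ≤ logWeight a b G q v := by
  have key : ∀ d : ℤ →₀ ℂ, (A * (d.sum fun _ z => ‖z‖ ^ 2)
        ≤ ‖d.sum fun p z => z • gaborSystem a b G (q, p)‖ ^ 2) ↔
      ∫⁻ v in Set.Ioo 0 (1 / b), ‖trigPoly b d v‖ₑ ^ 2 * ENNReal.ofReal (2 * A * b)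
        ≤ ∫⁻ v in Set.Ioo 0 (1 / b), ‖trigPoly b d v‖ₑ ^ 2 * logWeight a b G q v := by
    intro d
    rw [lintegral_trigPoly_mul_const hb d hA, lintegral_trigPoly_mul_logWeight a hb, two_mul_enorm_sq,
      ENNReal.ofReal_le_ofReal_iff (by positivity), mul_le_mul_iff_right₀ two_pos]
  simp_rw [key]
  refine ⟨fun h => ae_le_of_forall_trigPoly hb measurable_const (measurable_logWeight a b G q)
    (lintegral_const_Ioo_ne_top b _) (lintegral_logWeight_ne_top a hb G q) h, fun h d => ?_⟩
  refine lintegral_mono_ae ?_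
  filter_upwards [h] with v hv
  gcongr

theorem upper_bound_iff (a : ℝ) {b : ℝ} (hb : 0 < b) (G : L2HS n) (q : GaborIdx n) {B : ℝ}
    (hB : 0 < B) :
    (∀ d : ℤ →₀ ℂ, ‖d.sum fun p z => z • gaborSystem a b G (q, p)‖ ^ 2
        ≤ B * (d.sum fun _ z => ‖z‖ ^ 2)) ↔
      ∀ᵐ v ∂(volume.restrict (Set.Ioo 0 (1 / b))),
        logWeight a b G q v ≤ ENNReal.ofReal (2 * B * b) := by
  have key : ∀ d : ℤ →₀ ℂ, (‖d.sum fun p z => z • gaborSystem a b G (q, p)‖ ^ 2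
        ≤ B * (d.sum fun _ z => ‖z‖ ^ 2)) ↔
      ∫⁻ v in Set.Ioo 0 (1 / b), ‖trigPoly b d v‖ₑ ^ 2 * logWeight a b G q v
        ≤ ∫⁻ v in Set.Ioo 0 (1 / b), ‖trigPoly b d v‖ₑ ^ 2 * ENNReal.ofReal (2 * B * b) := by
    intro d
    have := sum_norm_sq_nonneg d
    rw [lintegral_trigPoly_mul_const hb d hB, lintegral_trigPoly_mul_logWeight a hb, two_mul_enorm_sq,
      ENNReal.ofReal_le_ofReal_iff (by positivity), mul_le_mul_iff_right₀ two_pos]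
  simp_rw [key]
  refine ⟨fun h => ae_le_of_forall_trigPoly hb (measurable_logWeight a b G q) measurable_const
    (lintegral_logWeight_ne_top a hb G q) (lintegral_const_Ioo_ne_top b _) h, fun h d => ?_⟩
  refine lintegral_mono_ae ?_
  filter_upwards [h] with v hv
  gcongr

theorem ae_gaborWeight_iff (a b : ℝ) (G : L2HS n) (q : GaborIdx n) (C D : ℝ) :
    (∀ᵐ ν ∂(volume.restrict (Set.Ioo 1 (Real.exp (1 / b)))),
        ENNReal.ofReal C ≤ gaborWeight a b G q ν ∧ gaborWeight a b G q ν ≤ ENNReal.ofReal D) ↔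
      ∀ᵐ v ∂(volume.restrict (Set.Ioo 0 (1 / b))),
        ENNReal.ofReal C ≤ logWeight a b G q v ∧ logWeight a b G q v ≤ ENNReal.ofReal D :=
  ae_Ioo_congr_log fun ν hν => by rw [gaborWeight_eq_logWeight a b G q hν]

theorem isRieszSequenceWithBounds_gaborSystem_iff {a b : ℝ} (hb : 0 < b) {G : L2HS n} {A B : ℝ}
    (hA : 0 < A) (hB : 0 < B) (h : FibrewiseOrthogonalSymbols a b G) :
    IsRieszSequenceWithBounds (gaborSystem a b G) A B ↔
      ∀ q : GaborIdx n, ∀ᵐ ν ∂(volume.restrict (Set.Ioo 1 (Real.exp (1 / b)))),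
        ENNReal.ofReal (2 * A * b) ≤ gaborWeight a b G q ν ∧
          gaborWeight a b G q ν ≤ ENNReal.ofReal (2 * B * b) := by
  have h1 : IsRieszSequenceWithBounds (gaborSystem a b G) A B ↔
      ∀ c : GaborIdx n × ℤ →₀ ℂ, A * (c.sum fun _ z => ‖z‖ ^ 2)
        ≤ ‖c.sum fun i z => z • gaborSystem a b G i‖ ^ 2 ∧
      ‖c.sum fun i z => z • gaborSystem a b G i‖ ^ 2 ≤ B * (c.sum fun _ z => ‖z‖ ^ 2) :=
    -- The Riesz property comes for free, so only the two inequalities have to be characterized.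
    ⟨fun H => H.2, fun H => ⟨isRieszSequence_of_bounds hA hB H, H⟩⟩
  rw [h1, bounds_iff hb h]
  refine forall_congr' fun q => ?_
  rw [ae_gaborWeight_iff, forall_and, lower_bound_iff a hb G q hA, upper_bound_iff a hb G q hB,
    Filter.eventually_and]

/-! #### The pointwise orthogonality condition -/

theorem schrodinger_zero_zero (lam t : ℝ) (φ : L2Rn n) :
    schrodinger lam 0 0 t φ = Complex.exp (2 * Real.pi * Complex.I * ((lam * t : ℝ) : ℂ)) • φ := by
  apply Lp.ext
  filter_upwards [coeFn_schrodinger lam 0 0 t φ,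
    Lp.coeFn_smul (Complex.exp (2 * Real.pi * Complex.I * ((lam * t : ℝ) : ℂ))) φ] with ξ h1 h2
  rw [h1, h2]
  simp [schrodingerFun, schrodingerPhase]

theorem intVec_zero : intVec (0 : Fin n → ℤ) = 0 := by
  ext i
  simp [intVec]

/-- The modulations by the centre of the Heisenberg group are multiplications by characters. -/
theorem coeFn_modulated_center (a : ℝ) (G : L2HS n) (m : ℤ) :
    ∀ᵐ x ∂haarMul, modulated a G (0, 0, m) x
      = Complex.exp (2 * Real.pi * Complex.I * ((x * (a * m) : ℝ) : ℂ)) • G x := by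
  filter_upwards [MemLp.coeFn_toLp (memLp_modulation ((2 * a) • intVec (0 : Fin n → ℤ))
    (a • intVec (0 : Fin n → ℤ)) (a * (m : ℝ)) G)] with x hx
  refine hx.trans ?_
  apply HS.toCLM_injective
  ext1 φ
  simp [HS.toCLM_compLeft, intVec_zero, schrodinger_zero_zero]

/-- Dilation by `e^t` turns the character of frequency `a m'` into that of frequency `a m' e^{-t} =
a m`, which the other factor cancels. -/
theorem inner_modulated_translation (a : ℝ) (G : L2HS n) {m m' : ℤ} {t : ℝ}
    (hm : (m' : ℝ) = m * Real.exp t) :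
    inner ℂ (modulated a G (0, 0, m))
        (translation (Units.mk0 (Real.exp t) (Real.exp_ne_zero t)) (modulated a G (0, 0, m')))
      = inner ℂ G (translation (Units.mk0 (Real.exp t) (Real.exp_ne_zero t)) G) := by
  rw [L2.inner_def, L2.inner_def]
  refine integral_congr_ae ?_
  have h1 := (measurePreserving_div (Units.mk0 (Real.exp t) (Real.exp_ne_zero t))
    ).quasiMeasurePreserving.ae (coeFn_modulated_center a G m')
  filter_upwards [coeFn_modulated_center a G m, h1, coeFn_translation_exp t G,
    coeFn_translation_exp t (modulated a G (0, 0, m'))] with x h1 h2 h3 h4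
  rw [Units.val_mk0] at h2
  rw [h1, h3, h4, h2, hm, inner_smul_left, inner_smul_right, ← mul_assoc,
    show x / Real.exp t * (a * (m * Real.exp t)) = x * (a * m) by field_simp, Complex.conj_mul',
    show ∀ r : ℝ, 2 * (Real.pi : ℂ) * Complex.I * (r : ℂ)
      = ((2 * Real.pi * r : ℝ) : ℂ) * Complex.I by intro r; push_cast; ring,
    Complex.norm_exp_ofReal_mul_I]
  simp

theorem inner_translation_eq (t : ℝ) (F F' : L2HS n) :
    inner ℂ F (translation (Units.mk0 (Real.exp t) (Real.exp_ne_zero t)) F')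
      = 1 / 2 * ∑ j : ℤˣ, ∫ v, Complex.exp (-(2 * Real.pi * Complex.I * ((t * v : ℝ) : ℂ))) *
        inner ℂ (groupFourier F (Real.exp v) j) (groupFourier F' (Real.exp v) j) := by
  rw [inner_eq_half_sum_groupFourierL2]
  congr 1
  refine Finset.sum_congr rfl fun j _ => ?_
  rw [inner_groupFourierL2]
  refine integral_congr_ae ?_
  filter_upwards [groupFourier_translate t (coeFn_translation_exp t F') j] with v hv
  rw [hv, inner_smul_right]

/-- Dominated convergence on the Fourier side, where `t` enters only through a unimodular phase. -/
theorem continuous_inner_translation (F : L2HS n) : Continuous fun t : ℝ =>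
    (inner ℂ F (translation (Units.mk0 (Real.exp t) (Real.exp_ne_zero t)) F) : ℂ) := by
  simp_rw [inner_translation_eq]
  refine continuous_const.mul (continuous_finsetSum _ fun j _ => ?_)
  have hI := integrable_inner_groupFourier j F F
  refine continuous_of_dominated (bound := fun v =>
    ‖(inner ℂ (groupFourier F (Real.exp v) j) (groupFourier F (Real.exp v) j) : ℂ)‖)
    (fun t => ?_) (fun t => Filter.Eventually.of_forall fun v => ?_) hI.norm
    (Filter.Eventually.of_forall fun v => by fun_prop)
  · exact (Continuous.aestronglyMeasurable (by fun_prop)).mul hI.1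
  · rw [norm_mul, norm_phase, one_mul]

/-- Every dilation multiplies the Fourier transform by scalars, which preserves pointwise
orthogonality; so `t` is arbitrary and not confined to `bℤ`. -/
theorem OrthogonalSymbols.inner_translation_eq_zero {a b : ℝ} (hb : 0 < b) {G : L2HS n}
    (h : OrthogonalSymbols a b G) {q q' : GaborIdx n} (hq : q ≠ q') (t : ℝ) :
    inner ℂ (modulated a G q)
      (translation (Units.mk0 (Real.exp t) (Real.exp_ne_zero t)) (modulated a G q')) = 0 := by
  have h1 : ∀ j, ∀ᵐ v, inner ℂ (gaborFourier a G q j v) (gaborFourier a G q' j v) = (0 : ℂ) := by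
    intro j
    rw [ae_volume_iff hb]
    intro s
    refine (ae_Ioo_congr_log (p := fun ν => inner ℂ (gaborSymbol a G q (ν * Real.exp (s / b)) j)
      (gaborSymbol a G q' (ν * Real.exp (s / b)) j) = (0 : ℂ)) fun ν hν => ?_).1 ?_
    · rw [inner_gaborSymbol a G q q' hν]
    · filter_upwards [h j s] with ν hν
      exact hν q q' hq
  rw [inner_translation_eq]
  refine mul_eq_zero_of_right _ (Finset.sum_eq_zero fun j _ => integral_eq_zero_of_ae ?_)
  filter_upwards [h1 j] with v hv
  exact mul_eq_zero_of_right _ hv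

/-- The pointwise orthogonality condition forces `𝒢 = 0`. -/
theorem OrthogonalSymbols.eq_zero {a b : ℝ} (hb : 0 < b) {G : L2HS n}
    (h : OrthogonalSymbols a b G) : G = 0 := by
  let K : ℝ → ℂ := fun t => inner ℂ G (translation (Units.mk0 (Real.exp t) (Real.exp_ne_zero t)) G)
  -- The integers `m = N + 1` and `m' = N + 2` are distinct with ratio `1 + 1/(N + 1)`, which tends
  -- to `1`; continuity of `K` then gives `K 0 = ‖𝒢‖² = 0`.
  have hK : ∀ N : ℕ, K (Real.log (1 + 1 / ((N : ℝ) + 1))) = 0 := by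
    intro N
    have hpos : 0 < 1 + 1 / ((N : ℝ) + 1) := by positivity
    have hm : (((N : ℤ) + 2 : ℤ) : ℝ) = ((N : ℤ) + 1 : ℤ)
        * Real.exp (Real.log (1 + 1 / ((N : ℝ) + 1))) := by
      rw [Real.exp_log hpos]
      push_cast
      field_simp
      ring
    rw [← h.inner_translation_eq_zero hb (q := (0, 0, (N : ℤ) + 1)) (q' := (0, 0, (N : ℤ) + 2))
      (by simp), inner_modulated_translation a G hm]
  have h1 : Filter.Tendsto (fun N : ℕ => Real.log (1 + 1 / ((N : ℝ) + 1))) Filter.atTop (nhds 0) := by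
    have h2 := (tendsto_one_div_add_atTop_nhds_zero_nat (𝕜 := ℝ)).const_add 1
    rw [add_zero] at h2
    have h3 := (Real.continuousAt_log one_ne_zero).tendsto.comp h2
    rwa [Real.log_one] at h3
  have h2 := ((continuous_inner_translation G).tendsto 0).comp h1
  have h3 : K 0 = 0 := by
    refine tendsto_nhds_unique h2 (tendsto_const_nhds.congr fun N => ?_)
    exact (hK N).symm
  have h4 : K 0 = inner ℂ G G := by
    simp only [K]
    rw [inner_translation_eq, inner_eq_half_sum_groupFourierL2]
    simp only [inner_groupFourierL2, zero_mul, Complex.ofReal_zero, mul_zero, neg_zero,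
      Complex.exp_zero, one_mul]
  rw [h4, inner_self_eq_zero] at h3
  exact h3

/-! ### Failure of both sides for `𝒢 = 0`. -/

theorem gaborSystem_zero (a b : ℝ) (i : GaborIdx n × ℤ) :
    gaborSystem a b (0 : L2HS n) i = 0 := by
  have h1 : modulated a (0 : L2HS n) i.1 = 0 := by
    apply Lp.ext
    filter_upwards [MemLp.coeFn_toLp (memLp_modulation ((2 * a) • intVec i.1.1) (a • intVec i.1.2.1)
      (a * (i.1.2.2 : ℝ)) (0 : L2HS n)), Lp.coeFn_zero (HS (L2Rn n)) 2 haarMul] with x h1 h2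
    refine h1.trans ?_
    rw [h2]
    apply HS.toCLM_injective
    ext1 φ
    simp [HS.toCLM_compLeft]
  rw [gaborSystem, h1, translation, map_zero]

theorem not_isRieszSequenceWithBounds_zero (a b : ℝ) {A B : ℝ} (hA : 0 < A) :
    ¬ IsRieszSequenceWithBounds (gaborSystem a b (0 : L2HS n)) A B := by
  intro h
  have h1 := (h.2 (Finsupp.single ((0, 0, 0), 0) 1)).1
  simp [gaborSystem_zero] at h1
  linarith

/-- The weight of `0` has integral zero over `(0, 1/b)`, which a positive lower bound excludes. -/
theorem not_ae_le_gaborWeight_zero (a : ℝ) {b : ℝ} (hb : 0 < b) {C D : ℝ} (hC : 0 < C) :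
    ¬ ∀ᵐ ν ∂(volume.restrict (Set.Ioo 1 (Real.exp (1 / b)))),
      ENNReal.ofReal C ≤ gaborWeight a b (0 : L2HS n) (0, 0, 0) ν ∧
        gaborWeight a b (0 : L2HS n) (0, 0, 0) ν ≤ ENNReal.ofReal D := by
  rw [ae_gaborWeight_iff]
  intro h
  have h1 : ∫⁻ v in Set.Ioo 0 (1 / b), logWeight a b (0 : L2HS n) (0, 0, 0) v = 0 := by
    have h2 := lintegral_trigPoly_mul_logWeight a hb (0 : L2HS n) (0, 0, 0) (Finsupp.single 0 1)
    simpa [trigPoly, gaborSystem_zero] using h2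
  have h2 : ∫⁻ _ in Set.Ioo 0 (1 / b), ENNReal.ofReal C ≤ 0 := by
    rw [← h1]
    refine lintegral_mono_ae ?_
    filter_upwards [h] with v hv using hv.1
  rw [lintegral_const, Measure.restrict_apply_univ, Real.volume_Ioo, sub_zero,
    ← ENNReal.ofReal_mul hC.le, nonpos_iff_eq_zero, ENNReal.ofReal_eq_zero] at h2
  have : 0 < C * (1 / b) := by positivity
  linarith

end GaborSystem

theorem mainTheorem6 (n : ℕ) (a b : ℝ) (ha : 0 < a) (hb : 0 < b) (G : L2HS n)
    (A B : ℝ) (hA : 0 < A) (hB : 0 < B) :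
    (OrthogonalSymbols a b G →
      (IsRieszSequenceWithBounds (gaborSystem a b G) A B ↔
        ∀ q : GaborIdx n, ∀ᵐ ν ∂(volume.restrict (Set.Ioo 1 (Real.exp (1 / b)))),
          ENNReal.ofReal (A * b) ≤ gaborWeight a b G q ν ∧
            gaborWeight a b G q ν ≤ ENNReal.ofReal (B * b))) ∧
    (FibrewiseOrthogonalSymbols a b G →
      (IsRieszSequenceWithBounds (gaborSystem a b G) A B ↔
        ∀ q : GaborIdx n, ∀ᵐ ν ∂(volume.restrict (Set.Ioo 1 (Real.exp (1 / b)))),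
          ENNReal.ofReal (2 * A * b) ≤ gaborWeight a b G q ν ∧
            gaborWeight a b G q ν ≤ ENNReal.ofReal (2 * B * b))) := by
  refine ⟨fun h => ?_, isRieszSequenceWithBounds_gaborSystem_iff hb hA hB⟩
  -- With `𝒢 = 0` both sides are false, so the equivalence holds in spite of the missing factor `2`.
  obtain rfl := h.eq_zero hb
  exact iff_of_false (not_isRieszSequenceWithBounds_zero a b hA)
    fun H => not_ae_le_gaborWeight_zero a hb (mul_pos hA hb) (H (0, 0, 0))
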